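/- **Setting.** Fix an integer $\bar m\ge1$, $r\in(0,2)$ and $\alpha>2\sqrt3$. For each sample size $n$ let $p=p(n)$ be the dimension, $p_n=p\vee n$, let $\lambda_1\ge\cdots\ge\lambda_{\bar m}>0$ (depending on $n$) and radii $s_1,\dots,s_{\bar m}$ (depending on $n$) be given, and put $\lambda_0^2=\infty$, $\lambda_{\bar m+1}^2=0$. A vector $u\in\mathbb R^p$ lies in the weak-$\ell_r$ ball $w\ell_r(s)$ if its ordered absolute coordinates $|u|_{(1)}\ge\cdots\ge|u|_{(p)}$ satisfy $|u|_{(\nu)}\le s\,\nu^{-1/r}$ for all $\nu$. Let $$\mathcal F_n=\Big\{\Sigma=\sum_{j=1}^{\bar m}\lambda_j^2q_jq_j'+I_p:\ q_1,\dots,q_{\bar m}\in\mathbb R^p\text{ orthonormal},\ q_j\in w\ell_r(s_j)\ \forall j\Big\}.$$ The data are $x_1,\dots,x_n$ i.i.d. $N_p(0,\Sigma)$ with $\Sigma\in\mathcal F_n$, and $S=\frac1n\sum_ix_ix_i'$. **Conditions.** As $n\to\infty$: (GR) (1) $(\log p)/n=o(1)$; (2) $\lambda_1^2=O(p_n)$,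 $\log p_n=o(n\lambda_{\bar m}^4)$ and $\lambda_1^2/\lambda_{\bar m}^2=O\big(n[\log(p_n)/n]^{1/2+r/4}\big)$; (3) for $j=1,\dots,\bar m$ the limit $\lim_n\lambda_1^2/(\lambda_j^2-\lambda_{j+1}^2)\in[1,\infty]$ exists (the ratio being $\infty$ when $\lambda_j=\lambda_{j+1}$). (SP) For $j=1,\dots,\bar m$, $s_j\ge1$ for all large $n$, and $s_j^r\big[\frac{\log p_n}{n\lambda_j^4}\big]^{1/2-r/4}=o(1\wedge\lambda_1^4)$. For $0\le j\le\bar m$ and $\kappa\ge1$, condition $\mathrm{AD}(j,\kappa)$ holds if $\lambda_j^2-\lambda_{j+1}^2\ge\lambda_1^2/\kappa$ for all sufficiently large $n$. **Estimator.** Let $\alpha_n=\alpha[\log(p_n)/n]^{1/2}$ and $B=\{\nu: S_{\nu\nu}\ge1+\alpha_n\}$. For $1\le j\le\operatorname{card}(B)$ let $\ell_j^B$ be the maximum of $1$ and the $j$-th largest eigenvalue of the submatrix $S_{BB}$. For $k\ge1$ let $$t_k^2=\frac{6\log p_n}{n}+\frac{2k(\log p_n+1)}{n},\quad t_k\ge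 0,\qquad \delta_k=2\big(\sqrt{k/n}+t_k\big)+\big(\sqrt{k/n}+t_k\big)^2 .$$ Define $\widehat m=\max\{j:\ 1\le j\le\operatorname{card}(B),\ \ell_j^B>1+\delta_{\operatorname{card}(B)}\}$, with $\max\emptyset=0$. **Proposition.** There is an absolute constant $C_0>0$ such that, whenever GR and SP hold: (a) for every $n\ge1$ and every $\Sigma\in\mathcal F_n$, $\widehat m\le\bar m$ with probability at least $1-C_0p_n^{-2}$; (b) there is an $N$, which may depend on the given sequences and parameters but not on $\Sigma$, such that for every $n\ge N$ and every $\Sigma\in\mathcal F_n$, with probability at least $1-C_0p_n^{-2}$ all of the following hold simultaneously: (1) $\widehat m\le\bar m$; (2) $m\le\widehat m$ for every $0\le m\le\bar m$ such that $\mathrm{AD}(m,\kappa)$ holds for some constant $\kappa\ge1$; (3) if $\mathrm{AD}(\bar m,\kappa)$ holds for some constant $\kappa\ge1$, then $\widehat m=\bar m$. -/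

import Mathlib

open MeasureTheory ProbabilityTheory Filter Topology Asymptotics

universe u

noncomputable section

namespace SparsePCA

/-- `p_n = p ∨ n`, as a real number. -/
def pn (p n : ℕ) : ℝ := ((max p n : ℕ) : ℝ)

/-! ### Estimator: computed from the data `x_1, …, x_n ∈ ℝ^p` (noise level `σ² = 1`) -/

/-- Sample covariance matrix `S = n⁻¹ ∑ᵢ xᵢ xᵢ'`. -/
def sampleCov {n p : ℕ} (x : Fin n → EuclideanSpace ℝ (Fin p)) :
    Matrix (Fin p) (Fin p) ℝ :=
  (1 / (n : ℝ)) • ∑ i, Matrix.vecMulVec (x i) (x i)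

/-- A sample covariance matrix is symmetric. -/
theorem sampleCov_isHermitian {n p : ℕ} (x : Fin n → EuclideanSpace ℝ (Fin p)) :
    (sampleCov x).IsHermitian := by
  ext i j
  simp [sampleCov, Matrix.sum_apply, Matrix.vecMulVec_apply, mul_comm]

/-- `α_n = α [log p_n / n]^{1/2}`. -/
def alphaN (α : ℝ) (p n : ℕ) : ℝ := α * Real.sqrt (Real.log (pn p n) / n)

/-- The selected coordinates `B = {ν : s_νν ≥ 1 + α_n}`. -/
def selected (α : ℝ) {n p : ℕ} (x : Fin n → EuclideanSpace ℝ (Fin p)) : Finset (Fin p) :=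
  {ν | 1 + alphaN α p n ≤ sampleCov x ν ν}

/-- `ℓ^B_j = ℓ_j(S_BB) ∨ 1` for `1 ≤ j ≤ card B`, where `ℓ_j` is the `j`-th largest eigenvalue
counted with multiplicity; the value is `1` for other `j`. (`eigenvalues₀` lists the eigenvalues
in decreasing order.) -/
def ellB (α : ℝ) {n p : ℕ} (x : Fin n → EuclideanSpace ℝ (Fin p)) (j : ℕ) : ℝ :=
  if h : 1 ≤ j ∧ j ≤ (selected α x).card then
    max (((sampleCov_isHermitian x).submatrix
      (Subtype.val : selected α x → Fin p)).eigenvalues₀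
        ⟨j - 1, by rw [Fintype.card_coe]; omega⟩) 1
  else 1

/-- `t_k`, where `t_k² = 6 log p_n / n + 2 k (log p_n + 1) / n`. -/
def tK (p n k : ℕ) : ℝ :=
  Real.sqrt (6 * Real.log (pn p n) / n + 2 * k * (Real.log (pn p n) + 1) / n)

/-- `δ_k = 2 (√(k/n) + t_k) + (√(k/n) + t_k)²`. -/
def deltaK (p n k : ℕ) : ℝ :=
  2 * (Real.sqrt (k / n) + tK p n k) + (Real.sqrt (k / n) + tK p n k) ^ 2

/-- The estimated number of spikes `max {j : ℓ^B_j > 1 + δ_{card B}}`, with `max ∅ = 0`. -/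
def hatM (α : ℝ) {n p : ℕ} (x : Fin n → EuclideanSpace ℝ (Fin p)) : ℕ :=
  ((Finset.Icc 1 (selected α x).card).filter
    fun j => 1 + deltaK p n (selected α x).card < ellB α x j).sup id

/-! ### Model: `lam n j` is `λ_j(n)` and `s n j` is the radius `s_j(n)`, with `j` numbered from
`0` in `Fin mbar` -/

/-- The spikes `λ_j²` numbered from `j = 1` to `mbar`; in particular `λ_{mbar+1}² = 0`. -/
def spikeSq {mbar : ℕ} (lam : ℕ → Fin mbar → ℝ) (n j : ℕ) : ℝ :=
  if h : 1 ≤ j ∧ j ≤ mbar then lam n ⟨j - 1, by omega⟩ ^ 2 else 0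

/-- `|u|_(ν+1)`: the coordinates of `u` in absolute value, in decreasing order. -/
def absOrdered {p : ℕ} (u : EuclideanSpace ℝ (Fin p)) (ν : Fin p) : ℝ :=
  |u (Tuple.sort (fun i => -|u i|) ν)|

/-- The weak-`ℓ_r` ball: `|u|_(ν) ≤ s ν^{-1/r}` for `ν = 1, …, p`. -/
def WeakBall (r s : ℝ) {p : ℕ} (u : EuclideanSpace ℝ (Fin p)) : Prop :=
  ∀ ν : Fin p, absOrdered u ν ≤ s * ((ν : ℝ) + 1) ^ (-1 / r)

/-- The uniformity class: all `Σ = ∑_j λ_j² q_j q_j' + I` with orthonormal `q_j ∈ wℓ_r(s_j)`. -/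
def spikedClass (r : ℝ) (p : ℕ) {mbar : ℕ} (lam s : Fin mbar → ℝ) :
    Set (Matrix (Fin p) (Fin p) ℝ) :=
  {Sig | ∃ q : Fin mbar → EuclideanSpace ℝ (Fin p), Orthonormal ℝ q ∧
    (∀ j, WeakBall r (s j) (q j)) ∧
    Sig = (∑ j, lam j ^ 2 • Matrix.vecMulVec (q j) (q j)) + 1}

/-- The growth rate condition. The limit in `gap` is taken in `[0, ∞]`; the ratio is `∞` where
`λ_j² = λ_{j+1}²`. -/
structure GR (r : ℝ) (p : ℕ → ℕ) {mbar : ℕ} (lam : ℕ → Fin mbar → ℝ) : Prop where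
  dim : (fun n => Real.log (p n) / n) =o[atTop] fun _ => (1 : ℝ)
  largest : (fun n => spikeSq lam n 1) =O[atTop] fun n => pn (p n) n
  smallest : (fun n => Real.log (pn (p n) n)) =o[atTop]
    fun n : ℕ => (n : ℝ) * spikeSq lam n mbar ^ 2
  ratio : (fun n => spikeSq lam n 1 / spikeSq lam n mbar) =O[atTop]
    fun n : ℕ => (n : ℝ) * (Real.log (pn (p n) n) / n) ^ (1 / 2 + r / 4)
  gap : ∀ j, 1 ≤ j → j ≤ mbar → ∃ L : ENNReal, 1 ≤ L ∧
    Tendsto (fun n => ENNReal.ofReal (spikeSq lam n 1) /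
      ENNReal.ofReal (spikeSq lam n j - spikeSq lam n (j + 1))) atTop (𝓝 L)

/-- The sparsity condition. -/
structure SP (r : ℝ) (p : ℕ → ℕ) {mbar : ℕ} (lam s : ℕ → Fin mbar → ℝ) : Prop where
  one_le : ∀ j, ∀ᶠ n in atTop, 1 ≤ s n j
  sparse : ∀ j, (fun n : ℕ => s n j ^ r *
      (Real.log (pn (p n) n) / (n * lam n j ^ 4)) ^ (1 / 2 - r / 4)) =o[atTop]
    fun n => min 1 (spikeSq lam n 1 ^ 2)

/-- Asymptotic distinguishability `AD(j, κ)`, with the conventions `λ_0² = ∞` (so that `AD(0, κ)`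
holds for every `κ ≥ 1`) and `λ_{mbar+1}² = 0`. -/
def AD {mbar : ℕ} (lam : ℕ → Fin mbar → ℝ) (j : ℕ) (κ : ℝ) : Prop :=
  1 ≤ κ ∧ (j = 0 ∨ ∀ᶠ n in atTop,
    spikeSq lam n 1 / κ ≤ spikeSq lam n j - spikeSq lam n (j + 1))

/-- The observations `X_1, …, X_n` are i.i.d. `N_p(0, Sig)` under `P`. -/
structure IsSample {Ω : Type*} [MeasurableSpace Ω] (P : Measure Ω) {n p : ℕ}
    (Sig : Matrix (Fin p) (Fin p) ℝ) (X : Fin n → Ω → EuclideanSpace ℝ (Fin p)) : Prop where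
  law : ∀ i, HasLaw (X i) (multivariateGaussian 0 Sig) P
  indep : iIndepFun X P

end SparsePCA

end

/-!
The estimate exceeds `m̄` only if noise imitates a spike. If `m̂ > m̄`, the selected submatrix of
`S` has an `(m̄ + 1)`-st eigenvalue above `1 + δ`, so by Courant–Fischer some unit vector that is
supported in the selected set `B` and orthogonal to all `q_j` has `v'Sv ≥ 1 + δ_{card B}`
(`mem_noiseExceeds_of_lt_hatM`). On the space of such vectors `Σ` is the identity, and
`n (1 + δ_k) = (√n + √k + √n t_k)²`. Since `B` depends on the data, this event is bounded for all
coordinate sets at once (`sampleLaw_noiseExceeds_le`), which requires the largest eigenvalue of a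
`k`-dimensional Wishart matrix to have nearly the Davidson–Szarek tail `exp (-n t² / 2)`. A slightly
weaker form of that tail, `sampleLaw_exists_large_le`, suffices and needs no Gaussian concentration.
For each such `v` the exponential `exp (β/2 ∑ᵢ ⟨xᵢ, v⟩² + n/2 log (1 - β ‖v‖²))` has mean one. By
Fubini and Markov, its average over the ball of radius `1 + ε` is at most `M` with probability
`1 - 1/M`. Where the quadratic form exceeds `(√n + u)²` at a unit vector `v₀`, Jensen's inequality
on the `ε`-ball around `v₀`, in which the displacements `±h` are paired, makes that average at
least `exp (u² / 2 - O(1))` times the volume ratio of the small to the large ball; a similar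
average over the `ε`-ball around the origin controls the part of the form that is quadratic in `h`.
The loss is `k log (7 + 6 u)`, with `u = √k + √n t_k`. The cross term `√k √n t_k` in `u²` and the
factor `1 / k!` in the number `p ^ k / k!` of coordinate sets pay for it as soon as `log p_n ≥ 100`
(`log_unionLevel_add_lt`). For smaller `p_n` the claimed probability bound is trivial when
`C₀ ≥ exp 200`.

For the reverse inequality, let `y = √(log p_n / n)`, which tends to zero. As `α > 2√3`, chi-square
tails show that with probability `1 - O(p_n⁻²)` the set `B` contains every coordinate of variance at
least `1 + 3 α y` and none of variance below `1 + d y`, where `3 d = α - 2√3`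
(`sampleLaw_selectionFails_le`). Truncating the spikes to the former coordinates changes them by
little, because a vector in a weak `ℓ_r` ball has little mass in its small coordinates
(`WeakBall.sum_min_sq_le`). The sample variances along the sums of two truncated spikes are within
a factor `1 ± 4 y` of the true ones, and polarisation extends this to their span, so that
`v'Sv ≥ (1 + λ_m² / 2) ‖v‖²` for `v` in the `m`-dimensional span of the first `m` truncated
spikes. The coordinates of variance at least `1 + d y` are few (`WeakBall.card_le`), hence
`δ_{card B} < λ_m² / 2` when `λ_m²` is comparable to `λ_1²`, and Courant–Fischer gives `m ≤ m̂`
(`le_hatM_of_not_mem`). The conditions SP and GR say that the rates that have to be small are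
small.
-/

namespace SparsePCA

open scoped ENNReal NNReal

/-! ### Exponential moments of the sample covariance form -/

/-- The moment generating function of a squared centred Gaussian variable. -/
theorem lintegral_exp_sq_gaussianReal (v : ℝ≥0) {t : ℝ} (ht : 2 * t * v < 1) :
    ∫⁻ z, ENNReal.ofReal (Real.exp (t * z ^ 2)) ∂(gaussianReal 0 v) =
      ENNReal.ofReal (Real.exp (-(1 / 2) * Real.log (1 - 2 * t * v))) := by
  rcases eq_or_ne v 0 with rfl | hv
  · simp
  have hv' : (0 : ℝ) < v := by positivity
  have hb : 0 < 1 / (2 * (v : ℝ)) - t := by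
    rw [sub_pos, lt_div_iff₀ (by positivity)]; linarith
  rw [gaussianReal_of_var_ne_zero _ hv, lintegral_withDensity_eq_lintegral_mul _
    (measurable_gaussianPDF 0 v) (by fun_prop)]
  have h1 : ∀ z : ℝ, (gaussianPDF 0 v * fun z => ENNReal.ofReal (Real.exp (t * z ^ 2))) z =
      ENNReal.ofReal ((Real.sqrt (2 * Real.pi * v))⁻¹ *
        Real.exp (-(1 / (2 * (v : ℝ)) - t) * z ^ 2)) := by
    intro z
    rw [Pi.mul_apply, gaussianPDF, ← ENNReal.ofReal_mul (gaussianPDFReal_nonneg _ _ _),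
      gaussianPDFReal, mul_assoc, ← Real.exp_add]
    congr 3
    field_simp
    ring
  simp_rw [h1]
  rw [← ofReal_integral_eq_lintegral_ofReal ((integrable_exp_neg_mul_sq hb).const_mul _)
    (ae_of_all _ fun z => by positivity), integral_const_mul, integral_gaussian]
  congr 1
  rw [← Real.sqrt_inv, ← Real.sqrt_mul (by positivity)]
  have h2 : (2 * Real.pi * v)⁻¹ * (Real.pi / (1 / (2 * (v : ℝ)) - t)) = (1 - 2 * t * v)⁻¹ := by
    have : (1 - 2 * t * v) ≠ 0 := by linarith
    field_simp
  have h3 : 0 < 1 - 2 * t * v := by linarith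
  rw [h2, Real.sqrt_eq_rpow, Real.rpow_def_of_pos (by positivity), Real.log_inv]
  ring_nf

/-- `∑ᵢ ⟨xᵢ, v⟩²`, that is `n v'Sv` for the sample covariance matrix `S` of `x`. -/
noncomputable def sampleForm {n p : ℕ} (x : Fin n → EuclideanSpace ℝ (Fin p))
    (v : EuclideanSpace ℝ (Fin p)) : ℝ :=
  ∑ i, (inner ℝ (x i) v) ^ 2

/-- The joint law of `n` independent `N(0, Sig)` vectors. -/
noncomputable def sampleLaw (n : ℕ) {p : ℕ} (Sig : Matrix (Fin p) (Fin p) ℝ) :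
    Measure (Fin n → EuclideanSpace ℝ (Fin p)) :=
  Measure.pi fun _ => multivariateGaussian 0 Sig

instance {n p : ℕ} (Sig : Matrix (Fin p) (Fin p) ℝ) : IsProbabilityMeasure (sampleLaw n Sig) := by
  unfold sampleLaw; infer_instance

/-- Bad events of the data have at most the probability that the joint law gives them;
measurability of `s` is not needed. -/
theorem IsSample.measure_le {Ω : Type*} [MeasurableSpace Ω] {P : Measure Ω}
    [IsProbabilityMeasure P] {n p : ℕ} {Sig : Matrix (Fin p) (Fin p) ℝ}
    {X : Fin n → Ω → EuclideanSpace ℝ (Fin p)} (h : IsSample P Sig X)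
    (s : Set (Fin n → EuclideanSpace ℝ (Fin p))) :
    P {ω | (fun i => X i ω) ∈ s} ≤ sampleLaw n Sig s := by
  have hm : ∀ i, AEMeasurable (X i) P := fun i => (h.law i).aemeasurable
  have := (iIndepFun_iff_map_fun_eq_pi_map hm).1 h.indep
  have h2 : P.map (fun ω i => X i ω) = sampleLaw n Sig := by
    rw [this, sampleLaw]
    congr 1
    ext1 i
    exact (h.law i).map_eq
  rw [← h2]
  exact Measure.le_map_apply (aemeasurable_pi_lambda _ hm) s

theorem map_inner_multivariateGaussian {p : ℕ} {Sig : Matrix (Fin p) (Fin p) ℝ}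
    (hS : Sig.PosSemidef) (v : EuclideanSpace ℝ (Fin p)) :
    (multivariateGaussian 0 Sig).map (fun y => inner ℝ y v) =
      gaussianReal 0 (v ⬝ᵥ Sig.mulVec v).toNNReal := by
  have := IsGaussian.map_eq_gaussianReal (μ := multivariateGaussian 0 Sig) (innerSL ℝ v)
  have h1 : (fun y => inner ℝ y v) = (innerSL ℝ v : EuclideanSpace ℝ (Fin p) → ℝ) := by
    ext y; simp [real_inner_comm]
  rw [h1, this]
  congr 1
  · rw [ContinuousLinearMap.integral_comp_id_comm, integral_id_multivariateGaussian, map_zero]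
    exact IsGaussian.integrable_id
  · rw [← covarianceBilin_multivariateGaussian (μ := 0) hS, covarianceBilin_self]
    · rfl
    · exact IsGaussian.memLp_two_id

theorem lintegral_pi_prod {n : ℕ} {E : Type*} [MeasurableSpace E] (μ : Measure E)
    [IsProbabilityMeasure μ] {f : E → ℝ≥0∞} (hf : Measurable f) :
    ∫⁻ x, ∏ i : Fin n, f (x i) ∂(Measure.pi fun _ : Fin n => μ) = (∫⁻ y, f y ∂μ) ^ n := by
  rw [lintegral_prod_eq_prod_lintegral_of_indepFun Finset.univ
    (fun (i : Fin n) (x : Fin n → E) => f (x i))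
    (iIndepFun_pi (X := fun _ : Fin n => f) fun i => hf.aemeasurable)
    fun i => hf.comp (measurable_pi_apply i)]
  have h4 : ∀ i : Fin n, ∫⁻ x : Fin n → E, f (x i) ∂(Measure.pi fun _ : Fin n => μ) =
      ∫⁻ y, f y ∂μ := fun i =>
    (measurePreserving_eval (fun _ : Fin n => μ) i).lintegral_comp hf
  simp_rw [h4]
  rw [Finset.prod_const, Finset.card_univ, Fintype.card_fin]

theorem dotProduct_mulVec_nonneg {p : ℕ} {Sig : Matrix (Fin p) (Fin p) ℝ}
    (hS : Sig.PosSemidef) (v : EuclideanSpace ℝ (Fin p)) : 0 ≤ v ⬝ᵥ Sig.mulVec v := by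
  have := hS.dotProduct_mulVec_nonneg (x := v.ofLp)
  rwa [star_trivial] at this

/-- The moment generating function of `∑ᵢ ⟨xᵢ, v⟩²`, which is `v'Σv` times a chi-square variable
with `n` degrees of freedom. -/
theorem lintegral_exp_sampleForm {n p : ℕ} {Sig : Matrix (Fin p) (Fin p) ℝ}
    (hS : Sig.PosSemidef) (v : EuclideanSpace ℝ (Fin p)) {t σ : ℝ}
    (hσ : v ⬝ᵥ Sig.mulVec v = σ) (ht : 2 * t * σ < 1) :
    ∫⁻ x, ENNReal.ofReal (Real.exp (t * sampleForm x v)) ∂(sampleLaw n Sig) =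
      ENNReal.ofReal (Real.exp (-(n / 2) * Real.log (1 - 2 * t * σ))) := by
  have hσ0 : 0 ≤ σ := hσ ▸ dotProduct_mulVec_nonneg hS v
  have h1 : ∀ x : Fin n → EuclideanSpace ℝ (Fin p),
      ENNReal.ofReal (Real.exp (t * sampleForm x v)) =
        ∏ i, ENNReal.ofReal (Real.exp (t * (inner ℝ (x i) v) ^ 2)) := by
    intro x
    rw [sampleForm, Finset.mul_sum, Real.exp_sum,
      ENNReal.ofReal_prod_of_nonneg fun i _ => (Real.exp_pos _).le]
  have h2 : ∫⁻ y, ENNReal.ofReal (Real.exp (t * (inner ℝ y v) ^ 2)) ∂multivariateGaussian 0 Sig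
      = ENNReal.ofReal (Real.exp (-(1 / 2) * Real.log (1 - 2 * t * σ))) := by
    have h3 := lintegral_exp_sq_gaussianReal σ.toNNReal (t := t)
      (by rwa [Real.coe_toNNReal _ hσ0])
    rw [Real.coe_toNNReal _ hσ0, ← hσ, ← map_inner_multivariateGaussian hS v,
      lintegral_map (by fun_prop) (by fun_prop), hσ] at h3
    exact h3
  simp_rw [h1]
  rw [sampleLaw, lintegral_pi_prod _
    (f := fun y => ENNReal.ofReal (Real.exp (t * (inner ℝ y v) ^ 2))) (by fun_prop), h2,
    ← ENNReal.ofReal_pow (Real.exp_pos _).le, ← Real.exp_nat_mul]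
  congr 2
  ring

/-! ### The largest sample eigenvalue on a subspace free of spikes -/

/-- Markov's inequality for an exponential functional, normalised to have mean one at every `v`
and averaged over a region `s` of a subspace on which `Σ` is the identity. -/
theorem sampleLaw_setIntegral_exp_gt_le {n p : ℕ} {Sig : Matrix (Fin p) (Fin p) ℝ}
    (hS : Sig.PosSemidef) (V : Submodule ℝ (EuclideanSpace ℝ (Fin p)))
    (hV : ∀ v ∈ V, v ⬝ᵥ Sig.mulVec v = ‖v‖ ^ 2) {s : Set V} (hs : IsCompact s)
    (hs0 : volume s ≠ 0) {t M : ℝ} (ht : ∀ v ∈ s, 2 * t * ‖v‖ ^ 2 < 1) (hM : 0 < M) :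
    sampleLaw n Sig {x | M * volume.real s <
        ∫ v in s, Real.exp (t * sampleForm x v + n / 2 * Real.log (1 - 2 * t * ‖v‖ ^ 2))} ≤
      ENNReal.ofReal (1 / M) := by
  set F : (Fin n → EuclideanSpace ℝ (Fin p)) → V → ℝ := fun x v =>
    Real.exp (t * sampleForm x v + n / 2 * Real.log (1 - 2 * t * ‖v‖ ^ 2)) with hF
  have hfin : volume s ≠ ∞ := hs.measure_lt_top.ne
  have hcont : Measurable fun z : (Fin n → EuclideanSpace ℝ (Fin p)) × V => F z.1 z.2 := by
    have h1 : Continuous fun z : (Fin n → EuclideanSpace ℝ (Fin p)) × V =>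
        sampleForm z.1 (z.2 : EuclideanSpace ℝ (Fin p)) := by
      unfold sampleForm; fun_prop
    have h1' := h1.measurable
    simp only [hF]
    fun_prop
  have hmean : ∫⁻ x, (∫⁻ v in s, ENNReal.ofReal (F x v)) ∂sampleLaw n Sig = volume s := by
    rw [lintegral_lintegral_swap hcont.ennreal_ofReal.aemeasurable]
    calc ∫⁻ v in s, ∫⁻ x, ENNReal.ofReal (F x v) ∂sampleLaw n Sig
        = ∫⁻ v in s, 1 := by
          refine setLIntegral_congr_fun hs.measurableSet fun v hv => ?_
          have h2 : ∀ x : Fin n → EuclideanSpace ℝ (Fin p), ENNReal.ofReal (F x v) =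
              ENNReal.ofReal (Real.exp (n / 2 * Real.log (1 - 2 * t * ‖v‖ ^ 2))) *
                ENNReal.ofReal (Real.exp (t * sampleForm x v)) := by
            intro x
            rw [hF, ← ENNReal.ofReal_mul (Real.exp_pos _).le, ← Real.exp_add, add_comm]
          simp_rw [h2]
          rw [lintegral_const_mul' _ _ ENNReal.ofReal_ne_top,
            lintegral_exp_sampleForm hS v (hV v v.2) (ht v hv),
            ← ENNReal.ofReal_mul (Real.exp_pos _).le, ← Real.exp_add]
          simp
      _ = volume s := by simp
  have hsub : {x | M * volume.real s < ∫ v in s, F x v} ⊆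
      {x | ENNReal.ofReal M * volume s ≤ ∫⁻ v in s, ENNReal.ofReal (F x v)} := by
    intro x hx
    have h3 : IntegrableOn (F x) s := by
      refine ContinuousOn.integrableOn_compact hs ?_
      have h1 : Continuous fun v : V => sampleForm x (v : EuclideanSpace ℝ (Fin p)) := by
        unfold sampleForm; fun_prop
      refine Real.continuous_exp.comp_continuousOn ?_
      refine (h1.const_smul t).continuousOn.add (ContinuousOn.mul continuousOn_const ?_)
      refine ContinuousOn.log (by fun_prop) fun v hv => ?_
      have := ht v hv
      linarith
    have h4 : ENNReal.ofReal (M * volume.real s) ≤ ENNReal.ofReal (∫ v in s, F x v) :=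
      ENNReal.ofReal_le_ofReal (le_of_lt hx)
    rw [ENNReal.ofReal_mul hM.le, measureReal_def, ENNReal.ofReal_toReal hfin,
      ofReal_integral_eq_lintegral_ofReal h3 (ae_of_all _ fun v => (Real.exp_pos _).le)] at h4
    exact h4
  refine (measure_mono hsub).trans ?_
  have h5 := mul_meas_ge_le_lintegral₀ (μ := sampleLaw n Sig)
    (f := fun x => ∫⁻ v in s, ENNReal.ofReal (F x v))
    (hcont.ennreal_ofReal.lintegral_prod_right').aemeasurable (ENNReal.ofReal M * volume s)
  rw [hmean] at h5
  rw [one_div, ENNReal.ofReal_inv_of_pos hM, ENNReal.le_inv_iff_mul_le,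
    ← ENNReal.mul_le_mul_iff_right hs0 hfin]
  calc _ = _ := ?_
    _ ≤ _ := h5
    _ = _ := (mul_one _).symm
  ring

/-- Jensen's inequality for the exponential function. -/
theorem exp_integral_le_integral_exp {α : Type*} [MeasurableSpace α] {ν : Measure α}
    [IsProbabilityMeasure ν] {f : α → ℝ} (hf : Integrable f ν)
    (hf' : Integrable (fun a => Real.exp (f a)) ν) :
    Real.exp (∫ a, f a ∂ν) ≤ ∫ a, Real.exp (f a) ∂ν :=
  convexOn_exp.map_integral_le Real.continuous_exp.continuousOn isClosed_univ
    (ae_of_all _ fun _ => Set.mem_univ _) hf hf'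

theorem neg_sub_sq_le_log_one_sub {z : ℝ} (hz : |z| ≤ 1 / 2) :
    -z - 2 * z ^ 2 ≤ Real.log (1 - z) := by
  have h := Real.abs_log_sub_add_sum_range_le (lt_of_le_of_lt hz (by norm_num)) 1
  simp only [Finset.range_one, Finset.sum_singleton, zero_add, pow_one, Nat.cast_zero,
    div_one] at h
  have h2 : |z| ^ (1 + 1) / (1 - |z|) ≤ 2 * z ^ 2 := by
    rw [div_le_iff₀ (by linarith), show |z| ^ (1 + 1) = z ^ 2 from sq_abs z]
    nlinarith [sq_nonneg z]
  linarith [(abs_le.1 (h.trans h2)).1]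

section BallAverage

variable {V : Type*} [NormedAddCommGroup V] [InnerProductSpace ℝ V] [FiniteDimensional ℝ V]
  [MeasurableSpace V] [BorelSpace V]

/-- The uniform distribution on the closed ball of radius `ε` around the origin. -/
noncomputable def ballAverage (V : Type*) [NormedAddCommGroup V] [InnerProductSpace ℝ V]
    [FiniteDimensional ℝ V] [MeasurableSpace V] [BorelSpace V] (ε : ℝ) : Measure V :=
  ProbabilityTheory.cond volume (Metric.closedBall (0 : V) ε)

theorem isProbabilityMeasure_ballAverage {ε : ℝ} (hε : 0 < ε) :
    IsProbabilityMeasure (ballAverage V ε) :=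
  cond_isProbabilityMeasure_of_finite (Metric.measure_closedBall_pos _ _ hε).ne'
    (isCompact_closedBall _ _).measure_lt_top.ne

theorem integral_ballAverage (ε : ℝ) (f : V → ℝ) : ∫ v, f v ∂ballAverage V ε =
    (volume.real (Metric.closedBall (0 : V) ε))⁻¹ * ∫ v in Metric.closedBall (0 : V) ε, f v := by
  rw [ballAverage, ProbabilityTheory.cond, integral_smul_measure, ENNReal.toReal_inv, smul_eq_mul,
    measureReal_def]

theorem volume_real_closedBall_pos {ε : ℝ} (hε : 0 < ε) :
    0 < volume.real (Metric.closedBall (0 : V) ε) := by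
  rw [measureReal_def]
  exact ENNReal.toReal_pos (Metric.measure_closedBall_pos _ _ hε).ne'
    (isCompact_closedBall _ _).measure_lt_top.ne

theorem integrable_ballAverage {ε : ℝ} (hε : 0 < ε) {f : V → ℝ}
    (hf : ContinuousOn f (Metric.closedBall (0 : V) ε)) : Integrable f (ballAverage V ε) := by
  rw [ballAverage, ProbabilityTheory.cond]
  exact (hf.integrableOn_compact (isCompact_closedBall _ _)).smul_measure
    (by simpa using (Metric.measure_closedBall_pos _ _ hε).ne')

theorem ae_norm_le_ballAverage (ε : ℝ) : ∀ᵐ h ∂ballAverage V ε, ‖h‖ ≤ ε := by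
  have := ae_cond_mem (μ := (volume : Measure V)) (s := Metric.closedBall (0 : V) ε)
    Metric.isClosed_closedBall.measurableSet
  filter_upwards [this] with h hh
  simpa using hh

theorem integral_ballAverage_neg (ε : ℝ) (f : V → ℝ) :
    ∫ v, f (-v) ∂ballAverage V ε = ∫ v, f v ∂ballAverage V ε := by
  rw [integral_ballAverage, integral_ballAverage]
  congr 1
  have hm : MeasurableSet (Metric.closedBall (0 : V) ε) := Metric.isClosed_closedBall.measurableSet
  rw [← integral_indicator hm, ← integral_indicator hm, ← integral_neg_eq_self
    (fun v => (Metric.closedBall (0 : V) ε).indicator f v) (volume : Measure V)]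
  congr 1
  ext v
  simp only [Set.indicator, Metric.mem_closedBall, dist_zero_right, norm_neg]

/-- An exponential moment of `-Q` over a ball bounds the mean of `Q h - n ‖h‖²` from below. -/
theorem integral_ballAverage_sub_ge {Q : V → ℝ} (hQc : Continuous Q) {n γ ε M : ℝ} (hn : 1 ≤ n)
    (hγ0 : 0 < γ) (hε0 : 0 < ε) (hM : 0 < M)
    (hK : ∫ v in Metric.closedBall (0 : V) ε,
        Real.exp (-(γ / 2) * Q v + n / 2 * Real.log (1 - 2 * (-(γ / 2)) * ‖v‖ ^ 2)) ≤
      M * volume.real (Metric.closedBall (0 : V) ε)) :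
    -γ / 2 * ∫ h, (Q h - n * ‖h‖ ^ 2) ∂ballAverage V ε - n * γ ^ 2 * ε ^ 4 / 4 ≤
      Real.log M := by
  have hν := isProbabilityMeasure_ballAverage (V := V) hε0
  have hDc : Continuous fun h : V => Q h - n * ‖h‖ ^ 2 := by fun_prop
  have hDi := integrable_ballAverage hε0 hDc.continuousOn
  set g : V → ℝ := fun v =>
    -(γ / 2) * Q v + n / 2 * Real.log (1 - 2 * (-(γ / 2)) * ‖v‖ ^ 2) with hg
  have hgc : Continuous g := by
    refine (hQc.const_smul (-(γ / 2))).add (continuous_const.mul ?_)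
    refine Continuous.log (by fun_prop) fun v => ?_
    have : 0 ≤ γ * ‖v‖ ^ 2 := by positivity
    linarith
  have h1 : Real.exp (∫ v, g v ∂ballAverage V ε) ≤ M := by
    refine (exp_integral_le_integral_exp (integrable_ballAverage hε0 hgc.continuousOn)
      (integrable_ballAverage hε0 (Real.continuous_exp.comp hgc).continuousOn)).trans ?_
    rw [integral_ballAverage, inv_mul_le_iff₀ (volume_real_closedBall_pos hε0), mul_comm]
    exact hK
  have h2 : ∫ v, g v ∂ballAverage V ε ≤ Real.log M := (Real.le_log_iff_exp_le hM).2 h1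
  refine le_trans ?_ h2
  have h3 : -γ / 2 * ∫ h, (Q h - n * ‖h‖ ^ 2) ∂ballAverage V ε - n * γ ^ 2 * ε ^ 4 / 4 =
      ∫ h, (-γ / 2 * (Q h - n * ‖h‖ ^ 2) - n * γ ^ 2 * ε ^ 4 / 4) ∂ballAverage V ε := by
    rw [integral_sub (hDi.const_mul _) (integrable_const _),
      integral_const_mul, integral_const]
    simp
  rw [h3]
  refine integral_mono_ae ((hDi.const_mul _).sub (integrable_const _))
    (integrable_ballAverage hε0 hgc.continuousOn) ?_
  filter_upwards [ae_norm_le_ballAverage ε] with h hh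
  have hw : 0 ≤ γ * ‖h‖ ^ 2 := by positivity
  have hw2 : γ * ‖h‖ ^ 2 - (γ * ‖h‖ ^ 2) ^ 2 / 2 ≤ Real.log (1 + γ * ‖h‖ ^ 2) := by
    refine le_trans ?_ (Real.le_log_one_add_of_nonneg hw)
    rw [le_div_iff₀ (by linarith)]
    nlinarith [pow_nonneg hw 3]
  have hw3 : (γ * ‖h‖ ^ 2) ^ 2 ≤ γ ^ 2 * ε ^ 4 := by
    have := pow_le_pow_left₀ (norm_nonneg h) hh 4
    nlinarith [sq_nonneg γ]
  have hn2 : 0 ≤ n / 2 := by linarith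
  have hw4 := mul_le_mul_of_nonneg_left hw2 hn2
  have hw5 := mul_le_mul_of_nonneg_left hw3 hn2
  simp only [hg]
  have : (1 : ℝ) - 2 * (-(γ / 2)) * ‖h‖ ^ 2 = 1 + γ * ‖h‖ ^ 2 := by ring
  rw [this]
  nlinarith

/-- Jensen's inequality on the ball around a unit vector, with the enlarged ball around the origin
paying the factor `((1 + ε) / ε) ^ dim V`. -/
theorem integral_ballAverage_translate_le {F : V → ℝ} {ε M : ℝ} (hε0 : 0 < ε) (hM : 0 < M)
    {v₀ : V} (hv₀ : ‖v₀‖ = 1) (hFc : ContinuousOn F (Metric.closedBall (0 : V) (1 + ε)))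
    (hJ : ∫ v in Metric.closedBall (0 : V) (1 + ε), Real.exp (F v) ≤
      M * volume.real (Metric.closedBall (0 : V) (1 + ε))) :
    ∫ h, F (v₀ + h) ∂ballAverage V ε ≤
      Real.log M + Module.finrank ℝ V * Real.log ((1 + ε) / ε) := by
  have hν := isProbabilityMeasure_ballAverage (V := V) hε0
  have hmaps : ∀ h ∈ Metric.closedBall (0 : V) ε,
      v₀ + h ∈ Metric.closedBall (0 : V) (1 + ε) := by
    intro h hh
    rw [mem_closedBall_zero_iff] at hh ⊢
    exact (norm_add_le _ _).trans (by rw [hv₀]; linarith)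
  have hFc' : ContinuousOn (fun h => F (v₀ + h)) (Metric.closedBall (0 : V) ε) :=
    hFc.comp (by fun_prop) hmaps
  have hR : 0 < (1 + ε) / ε := by positivity
  have h1 : Real.exp (∫ h, F (v₀ + h) ∂ballAverage V ε) ≤
      M * ((1 + ε) / ε) ^ Module.finrank ℝ V := by
    refine (exp_integral_le_integral_exp (integrable_ballAverage hε0 hFc')
      (integrable_ballAverage hε0 (Real.continuous_exp.comp_continuousOn hFc'))).trans ?_
    rw [integral_ballAverage, inv_mul_le_iff₀ (volume_real_closedBall_pos hε0)]
    have h2 : ∫ h in Metric.closedBall (0 : V) ε, Real.exp (F (v₀ + h)) =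
        ∫ v in Metric.closedBall v₀ ε, Real.exp (F v) := by
      rw [← (measurePreserving_add_left (volume : Measure V) v₀).setIntegral_preimage_emb
        (measurableEmbedding_addLeft v₀) (fun v => Real.exp (F v)) (Metric.closedBall v₀ ε)]
      congr 2
      ext h
      simp
    have h3 : ∫ v in Metric.closedBall v₀ ε, Real.exp (F v) ≤
        ∫ v in Metric.closedBall (0 : V) (1 + ε), Real.exp (F v) := by
      refine setIntegral_mono_set ((Real.continuous_exp.comp_continuousOn
        hFc).integrableOn_compact (isCompact_closedBall _ _))
        (ae_of_all _ fun v => (Real.exp_pos _).le) (LE.le.eventuallyLE ?_)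
      intro v hv
      have := hmaps (v - v₀) (by simpa [← dist_eq_norm] using hv)
      simpa using this
    have h4 : volume.real (Metric.closedBall (0 : V) (1 + ε)) =
        ((1 + ε) / ε) ^ Module.finrank ℝ V * volume.real (Metric.closedBall (0 : V) ε) := by
      rw [measureReal_def, measureReal_def, Measure.addHaar_closedBall _ _ (by positivity),
        Measure.addHaar_closedBall _ _ hε0.le, ENNReal.toReal_mul, ENNReal.toReal_mul,
        ENNReal.toReal_ofReal (by positivity), ENNReal.toReal_ofReal (by positivity), div_pow]
      field_simp
    rw [h2]
    refine h3.trans (hJ.trans (le_of_eq ?_))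
    rw [h4]; ring
  have h6 := (Real.le_log_iff_exp_le (by positivity)).2 h1
  rwa [Real.log_mul hM.ne' (by positivity), Real.log_pow] at h6

end BallAverage

section Displacement

variable {V : Type*} [NormedAddCommGroup V] [InnerProductSpace ℝ V]

/-- The normalised exponent `β/2 Q(v) + n/2 log(1 - β‖v‖²)` near a unit vector, averaged over `±h`.
With `β = y / (1 + y)` the terms without `h` amount to `n y² / 2`. -/
theorem half_sum_exponent_ge {Q : V → ℝ} (hQ : ∀ v h, Q (v + h) + Q (v - h) = 2 * Q v + 2 * Q h)
    {n y β ε : ℝ} (hn : 0 ≤ n) (hy0 : 0 < y) (hβ : β = y / (1 + y)) (hε0 : 0 < ε) (hε1 : ε ≤ 1)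
    (hyε : 3 * y * ε ≤ 1 / 2) (hnyε : n * (y * ε) ^ 2 ≤ 1 / 36)
    {v₀ h : V} (hv₀ : ‖v₀‖ = 1) (hQv₀ : n * (1 + y) ^ 2 ≤ Q v₀) (hh : ‖h‖ ≤ ε) :
    n * y ^ 2 / 2 - 1 / 2 + β / 2 * (Q h - n * ‖h‖ ^ 2) ≤
      ((β / 2 * Q (v₀ + h) + n / 2 * Real.log (1 - 2 * (β / 2) * ‖v₀ + h‖ ^ 2)) +
        (β / 2 * Q (v₀ - h) + n / 2 * Real.log (1 - 2 * (β / 2) * ‖v₀ - h‖ ^ 2))) / 2 := by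
  have hβ0 : 0 < β := by rw [hβ]; positivity
  have hβ1 : 1 - β = 1 / (1 + y) := by rw [hβ]; field_simp; ring
  have hβ1' : 0 < 1 - β := by rw [hβ1]; positivity
  have hlog : ∀ h : V, ‖h‖ ≤ ε →
      Real.log (1 - β) - y * (2 * inner ℝ v₀ h + ‖h‖ ^ 2) - 18 * (y * ε) ^ 2 ≤
      Real.log (1 - 2 * (β / 2) * ‖v₀ + h‖ ^ 2) := by
    intro h hh
    have h1 : |y * (2 * inner ℝ v₀ h + ‖h‖ ^ 2)| ≤ 3 * y * ε := by
      have h1 : |inner ℝ v₀ h| ≤ ε := by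
        refine (abs_real_inner_le_norm v₀ h).trans ?_
        rw [hv₀, one_mul]; exact hh
      have h2 : ‖h‖ ^ 2 ≤ ε := by
        have := pow_le_pow_left₀ (norm_nonneg h) hh 2
        nlinarith
      have h4 : |2 * inner ℝ v₀ h + ‖h‖ ^ 2| ≤ 3 * ε := by
        have := abs_le.1 h1
        rw [abs_le]; constructor <;> nlinarith [sq_nonneg ‖h‖]
      rw [abs_mul, abs_of_pos hy0]
      nlinarith
    have h2 := neg_sub_sq_le_log_one_sub (h1.trans hyε)
    have h3 := abs_le.1 (h1.trans hyε)
    have hid : 1 - 2 * (β / 2) * ‖v₀ + h‖ ^ 2 =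
        (1 - β) * (1 - y * (2 * inner ℝ v₀ h + ‖h‖ ^ 2)) := by
      rw [norm_add_sq_real, hv₀]
      have : (1 - β) * y = β := by rw [hβ1, hβ]; field_simp
      linear_combination ((2 * inner ℝ v₀ h + ‖h‖ ^ 2)) * this
    rw [hid, Real.log_mul hβ1'.ne' (by linarith)]
    have h4 := pow_le_pow_left₀ (abs_nonneg _) h1 2
    rw [sq_abs] at h4
    nlinarith
  have e1 := hlog h hh
  have e2 := hlog (-h) (by simpa using hh)
  rw [← sub_eq_add_neg, inner_neg_right, norm_neg] at e2
  have e3 : -y ≤ Real.log (1 - β) := by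
    rw [hβ1, one_div, Real.log_inv]
    have := Real.log_le_sub_one_of_pos (show 0 < 1 + y by linarith)
    linarith
  have e5 := hQ v₀ h
  have e7 : β * (1 + y) = y := by rw [hβ]; field_simp
  have e8 : β / 2 * (n * (1 + y) ^ 2) ≤ β / 2 * Q v₀ :=
    mul_le_mul_of_nonneg_left hQv₀ (by positivity)
  have e9 : β / 2 * (n * (1 + y) ^ 2) = n / 2 * (y + y ^ 2) := by
    linear_combination (n / 2 * (1 + y)) * e7
  have e10 : ‖h‖ ^ 2 ≤ ε ^ 2 := pow_le_pow_left₀ (norm_nonneg h) hh 2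
  have e11 : (y - β) * n * ‖h‖ ^ 2 ≤ 1 / 36 := by
    have h1 : y - β ≤ y ^ 2 := by nlinarith
    have h3 : (y - β) * n ≤ n * y ^ 2 := by nlinarith
    calc (y - β) * n * ‖h‖ ^ 2 ≤ (n * y ^ 2) * ε ^ 2 :=
          mul_le_mul h3 e10 (by positivity) (by positivity)
      _ = n * (y * ε) ^ 2 := by ring
      _ ≤ _ := hnyε
  have hn4 : 0 ≤ n / 4 := by linarith
  have e12 := mul_le_mul_of_nonneg_left (add_le_add e1 e2) hn4
  have e13 := mul_le_mul_of_nonneg_left e3 (show 0 ≤ n / 2 by linarith)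
  have e14 : β / 2 * (Q (v₀ + h) + Q (v₀ - h)) = β / 2 * (2 * Q v₀ + 2 * Q h) := by rw [e5]
  set l₁ := Real.log (1 - 2 * (β / 2) * ‖v₀ + h‖ ^ 2)
  set l₂ := Real.log (1 - 2 * (β / 2) * ‖v₀ - h‖ ^ 2)
  linarith

end Displacement

/-- The deterministic half of the bound on the largest eigenvalue. If a nonnegative quadratic form
`Q` (here only the parallelogram law is used) takes a value `≥ (√n + u)²` at a unit vector `v₀`,
then one of two exponential averages of `Q` over balls is large. Around `v₀`, the first average is
bounded below by Jensen's inequality; the terms that are odd in the displacement cancel by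
symmetry, and the second average controls the mean of `Q` over displacements. -/
theorem sq_div_two_le_of_exp_averages_le {V : Type*} [NormedAddCommGroup V]
    [InnerProductSpace ℝ V] [FiniteDimensional ℝ V] [MeasurableSpace V] [BorelSpace V]
    {Q : V → ℝ} (hQc : Continuous Q) (hQ : ∀ v h, Q (v + h) + Q (v - h) = 2 * Q v + 2 * Q h)
    {n u M : ℝ} (hn : 1 ≤ n) (hu : 0 < u) (hM : 0 < M) (hMu : Real.log M ≤ u ^ 2)
    {β γ ε : ℝ} (hβ : β = (u / √n) / (1 + u / √n)) (hγ : γ = β * u ^ 2)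
    (hε : ε = 1 / (6 * (1 + u)))
    {v₀ : V} (hv₀ : ‖v₀‖ = 1) (hQv₀ : (√n + u) ^ 2 ≤ Q v₀)
    (hJ : ∫ v in Metric.closedBall (0 : V) (1 + ε),
        Real.exp (β / 2 * Q v + n / 2 * Real.log (1 - 2 * (β / 2) * ‖v‖ ^ 2)) ≤
      M * volume.real (Metric.closedBall (0 : V) (1 + ε)))
    (hK : ∫ v in Metric.closedBall (0 : V) ε,
        Real.exp (-(γ / 2) * Q v + n / 2 * Real.log (1 - 2 * (-(γ / 2)) * ‖v‖ ^ 2)) ≤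
      M * volume.real (Metric.closedBall (0 : V) ε)) :
    u ^ 2 / 2 - 2 ≤ Real.log M + Module.finrank ℝ V * Real.log (7 + 6 * u) := by
  have hsn : 1 ≤ √n := by rw [Real.one_le_sqrt]; exact hn
  have hsn2 : √n ^ 2 = n := Real.sq_sqrt (by linarith)
  set y := u / √n with hy
  have hy0 : 0 < y := by positivity
  have hyu : y * √n = u := by rw [hy]; field_simp
  have hyn : n * y ^ 2 = u ^ 2 := by rw [← hyu, mul_pow, hsn2]; ring
  have hyleu : y ≤ u := div_le_self hu.le hsn
  have hβ0 : 0 < β := by rw [hβ]; positivity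
  have hβ1 : 1 - β = 1 / (1 + y) := by rw [hβ]; field_simp; ring
  have hβ1' : 0 < 1 - β := by rw [hβ1]; positivity
  have hβy : β ≤ y := by rw [hβ]; exact div_le_self hy0.le (by linarith)
  have hε0 : 0 < ε := by rw [hε]; positivity
  have hεu : ε * (1 + u) = 1 / 6 := by rw [hε]; field_simp
  have hεu' : ε * u ≤ 1 / 6 := by linarith
  have hε1 : ε ≤ 1 / 6 := by linarith [mul_pos hε0 hu]
  have hyε : 3 * y * ε ≤ 1 / 2 := by
    have := mul_le_mul_of_nonneg_right hyleu hε0.le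
    linarith
  have hγ0 : 0 < γ := by rw [hγ]; positivity
  have hν := isProbabilityMeasure_ballAverage (V := V) hε0
  have hDc : Continuous fun h : V => Q h - n * ‖h‖ ^ 2 := by fun_prop
  have hDi := integrable_ballAverage hε0 hDc.continuousOn
  have hDlow := integral_ballAverage_sub_ge hQc hn hγ0 hε0 hM hK
  set D := ∫ h, (Q h - n * ‖h‖ ^ 2) ∂ballAverage V ε with hD
  have hDlow' : -1 - 1 / 100 ≤ β / 2 * D := by
    have h2 : n * γ ^ 2 * ε ^ 4 / 4 ≤ u ^ 2 / 100 := by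
      have h3 : n * β ^ 2 ≤ u ^ 2 := by
        rw [← hyn]
        exact mul_le_mul_of_nonneg_left (pow_le_pow_left₀ hβ0.le hβy 2) (by linarith)
      have h4 : (ε * u) ^ 4 ≤ (1 / 6) ^ 4 := pow_le_pow_left₀ (by positivity) hεu' 4
      have h5 : n * γ ^ 2 * ε ^ 4 / 4 = (n * β ^ 2) * (ε * u) ^ 4 / 4 := by rw [hγ]; ring
      rw [h5]
      have h6 : (n * β ^ 2) * (ε * u) ^ 4 ≤ u ^ 2 * (1 / 6) ^ 4 :=
        mul_le_mul h3 h4 (by positivity) (by positivity)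
      linarith [sq_nonneg u]
    have h8 : -γ / 2 * D = u ^ 2 * (-(β / 2 * D)) := by rw [hγ]; ring
    have h7 : u ^ 2 * (-(β / 2 * D)) ≤ u ^ 2 * (1 + 1 / 100) := by linarith
    have := le_of_mul_le_mul_left h7 (by positivity)
    linarith
  set F : V → ℝ := fun v => β / 2 * Q v + n / 2 * Real.log (1 - 2 * (β / 2) * ‖v‖ ^ 2) with hF
  have hpos : ∀ v ∈ Metric.closedBall (0 : V) (1 + ε), 1 - 2 * (β / 2) * ‖v‖ ^ 2 ≠ 0 := by
    intro v hv
    have hv' : ‖v‖ ≤ 1 + ε := by simpa using hv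
    have h1 : ‖v‖ ^ 2 ≤ (1 + ε) ^ 2 := pow_le_pow_left₀ (norm_nonneg v) hv' 2
    have h2 : (1 + ε) ^ 2 ≤ 1 + 3 * ε := by nlinarith
    have h3 : (1 - β) * y = β := by rw [hβ1, hβ]; field_simp
    have h4 : β * (3 * ε) ≤ (1 - β) / 2 := by
      calc β * (3 * ε) = (1 - β) * (3 * y * ε) := by linear_combination (-3 * ε) * h3
        _ ≤ (1 - β) * (1 / 2) := mul_le_mul_of_nonneg_left hyε hβ1'.le
        _ = _ := by ring
    have h5 : β * ‖v‖ ^ 2 ≤ β * (1 + 3 * ε) := mul_le_mul_of_nonneg_left (h1.trans h2) hβ0.le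
    apply ne_of_gt
    linarith
  have hFc : ContinuousOn F (Metric.closedBall (0 : V) (1 + ε)) := by
    refine (hQc.const_smul (β / 2)).continuousOn.add (continuousOn_const.mul ?_)
    exact ContinuousOn.log (by fun_prop) hpos
  have hup := integral_ballAverage_translate_le hε0 hM hv₀ hFc hJ
  have hR : (1 + ε) / ε = 7 + 6 * u := by rw [hε]; field_simp; ring
  rw [hR] at hup
  have hmaps : ∀ h ∈ Metric.closedBall (0 : V) ε,
      v₀ + h ∈ Metric.closedBall (0 : V) (1 + ε) := by
    intro h hh
    rw [mem_closedBall_zero_iff] at hh ⊢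
    exact (norm_add_le _ _).trans (by rw [hv₀]; linarith)
  have hFi : Integrable (fun h => F (v₀ + h)) (ballAverage V ε) :=
    integrable_ballAverage hε0 (hFc.comp (by fun_prop) hmaps)
  have hFi' : Integrable (fun h => F (v₀ - h)) (ballAverage V ε) := by
    refine integrable_ballAverage hε0 (hFc.comp (by fun_prop) fun h hh => ?_)
    have := hmaps (-h) (by simpa using hh)
    rwa [← sub_eq_add_neg] at this
  have hsymF : ∫ h, F (v₀ + h) ∂ballAverage V ε =
      ∫ h, (F (v₀ + h) + F (v₀ - h)) / 2 ∂ballAverage V ε := by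
    have h1 := integral_ballAverage_neg ε fun h => F (v₀ + h)
    simp only [← sub_eq_add_neg] at h1
    rw [integral_div, integral_add hFi hFi', h1]
    ring
  have hnyε : n * (y * ε) ^ 2 ≤ 1 / 36 := by
    have h1 : n * (y * ε) ^ 2 = (ε * u) ^ 2 := by rw [mul_pow, ← mul_assoc, hyn]; ring
    rw [h1]
    have : (ε * u) ^ 2 ≤ (1 / 6) ^ 2 := pow_le_pow_left₀ (by positivity) hεu' 2
    linarith
  have hQv₀' : n * (1 + y) ^ 2 ≤ Q v₀ := by
    refine le_trans (le_of_eq ?_) hQv₀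
    rw [← hyu]
    linear_combination (-(1 + y) ^ 2) * hsn2
  have hfin : n * y ^ 2 / 2 - 1 / 2 + β / 2 * D ≤ ∫ h, F (v₀ + h) ∂ballAverage V ε := by
    have h1 : n * y ^ 2 / 2 - 1 / 2 + β / 2 * D =
        ∫ h, (n * y ^ 2 / 2 - 1 / 2 + β / 2 * (Q h - n * ‖h‖ ^ 2)) ∂ballAverage V ε := by
      rw [integral_add (integrable_const _) (hDi.const_mul _), integral_const_mul, integral_const]
      simp [hD]
    rw [hsymF, h1]
    refine integral_mono_ae ((integrable_const _).add (hDi.const_mul _))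
      ((hFi.add hFi').div_const 2) ?_
    filter_upwards [ae_norm_le_ballAverage ε] with h hh
    exact half_sum_exponent_ge hQ (by linarith) hy0 hβ hε0 (by linarith) hyε hnyε hv₀ hQv₀' hh
  rw [hyn] at hfin
  linarith

/-- Uniform upper bound for `∑ᵢ ⟨xᵢ, v⟩²` over the unit sphere of a subspace of dimension at most
`k` on which `Σ` is the identity. -/
theorem sampleLaw_exists_large_le {n p k : ℕ} (hn : 1 ≤ n) {Sig : Matrix (Fin p) (Fin p) ℝ}
    (hS : Sig.PosSemidef) (V : Submodule ℝ (EuclideanSpace ℝ (Fin p)))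
    (hV : ∀ v ∈ V, v ⬝ᵥ Sig.mulVec v = ‖v‖ ^ 2) (hk : Module.finrank ℝ V ≤ k)
    {u M : ℝ} (hu : 0 < u) (hM : 0 < M) (hMu : Real.log M ≤ u ^ 2)
    (hlt : Real.log M + k * Real.log (7 + 6 * u) < u ^ 2 / 2 - 2) :
    sampleLaw n Sig {x | ∃ v ∈ V, ‖v‖ = 1 ∧ (√n + u) ^ 2 ≤ sampleForm x v} ≤
      ENNReal.ofReal (2 / M) := by
  have hn' : (1 : ℝ) ≤ n := by exact_mod_cast hn
  obtain ⟨β, hβ⟩ : ∃ β, β = (u / √(n : ℝ)) / (1 + u / √(n : ℝ)) := ⟨_, rfl⟩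
  obtain ⟨ε, hε⟩ : ∃ ε, ε = 1 / (6 * (1 + u)) := ⟨_, rfl⟩
  have hsn : (1 : ℝ) ≤ √n := by rw [Real.one_le_sqrt]; exact hn'
  have hε0 : 0 < ε := by rw [hε]; positivity
  have hβ0 : 0 < β := by rw [hβ]; positivity
  have hγ0 : 0 < β * u ^ 2 := by positivity
  have hβε : β * (1 + ε) ^ 2 < 1 := by
    have hy : u / √(n : ℝ) ≤ u := div_le_self hu.le hsn
    have h1 : β ≤ u / (1 + u) := by
      rw [hβ, div_le_div_iff₀ (by positivity) (by positivity)]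
      nlinarith
    have h2 : ε ≤ 1 / 6 := by
      rw [hε]; apply one_div_le_one_div_of_le <;> linarith
    have h3 : ε * (1 + u) = 1 / 6 := by rw [hε]; field_simp
    have h4 : (1 + ε) ^ 2 ≤ 1 + 3 * ε := by nlinarith
    calc β * (1 + ε) ^ 2 ≤ u / (1 + u) * (1 + 3 * ε) :=
          mul_le_mul h1 h4 (by positivity) (by positivity)
      _ < 1 := by
        rw [div_mul_eq_mul_div, div_lt_one (by positivity)]
        nlinarith
  have hJ := sampleLaw_setIntegral_exp_gt_le (n := n) hS V hV (s := Metric.closedBall 0 (1 + ε))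
    (isCompact_closedBall _ _) (Metric.measure_closedBall_pos _ _ (by linarith)).ne'
    (t := β / 2) (M := M) (fun v hv => by
      have h1 : ‖v‖ ≤ 1 + ε := by simpa using hv
      have h2 : ‖v‖ ^ 2 ≤ (1 + ε) ^ 2 := pow_le_pow_left₀ (norm_nonneg v) h1 2
      have h3 := mul_le_mul_of_nonneg_left h2 hβ0.le
      linarith) hM
  have hK := sampleLaw_setIntegral_exp_gt_le (n := n) hS V hV (s := Metric.closedBall 0 ε)
    (isCompact_closedBall _ _) (Metric.measure_closedBall_pos _ _ hε0).ne'
    (t := -(β * u ^ 2 / 2)) (M := M) (fun v hv => by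
      have h1 : 0 ≤ β * u ^ 2 * ‖v‖ ^ 2 := by positivity
      linarith) hM
  have h2M : ENNReal.ofReal (2 / M) = ENNReal.ofReal (1 / M) + ENNReal.ofReal (1 / M) := by
    rw [← ENNReal.ofReal_add (by positivity) (by positivity)]
    congr 1; ring
  rw [h2M]
  refine (measure_mono ?_).trans ((measure_union_le _ _).trans (add_le_add hJ hK))
  rintro x ⟨v, hvV, hv1, hvQ⟩
  by_contra hx
  simp only [Set.mem_union, Set.mem_ofPred_eq, not_or, not_lt] at hx
  have hQc : Continuous fun w : V => sampleForm x (w : EuclideanSpace ℝ (Fin p)) := by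
    unfold sampleForm; fun_prop
  have hQ : ∀ v h : V, sampleForm x ((v + h : V) : EuclideanSpace ℝ (Fin p)) +
      sampleForm x ((v - h : V) : EuclideanSpace ℝ (Fin p)) =
      2 * sampleForm x (v : EuclideanSpace ℝ (Fin p)) +
        2 * sampleForm x (h : EuclideanSpace ℝ (Fin p)) := by
    intro v h
    simp only [sampleForm, ← Finset.sum_add_distrib, Finset.mul_sum]
    refine Finset.sum_congr rfl fun i _ => ?_
    rw [Submodule.coe_add, Submodule.coe_sub, inner_add_right, inner_sub_right]
    ring
  have := sq_div_two_le_of_exp_averages_le hQc hQ hn' hu hM hMu hβ rfl hε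
    (v₀ := ⟨v, hvV⟩) (by simpa using hv1) hvQ hx.1 hx.2
  have hlog : 0 ≤ Real.log (7 + 6 * u) := Real.log_nonneg (by linarith)
  have hk' : (Module.finrank ℝ V : ℝ) ≤ k := by exact_mod_cast hk
  nlinarith

/-! ### Noise over all sets of coordinates -/

theorem log_factorial_ge {k : ℕ} (hk : 1 ≤ k) :
    k * Real.log k - k ≤ Real.log (k.factorial) := by
  have hk0 : (0 : ℝ) < k := by exact_mod_cast hk
  have h := Real.pow_div_factorial_le_exp (x := (k : ℝ)) hk0.le k
  have hf : (0 : ℝ) < k.factorial := by exact_mod_cast k.factorial_pos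
  have h2 := Real.log_le_log (by positivity) h
  rw [Real.log_exp, Real.log_div (by positivity) hf.ne', Real.log_pow] at h2
  linarith

/-- The level `M` with which the deviation bound is applied to one set of `k` coordinates; the
factor `k!` offsets the number of such sets. -/
noncomputable def unionLevel (P : ℝ) (k : ℕ) : ℝ := 2 ^ k * P ^ (k + 2) / k.factorial

theorem unionLevel_pos {P : ℝ} (hP : 0 < P) (k : ℕ) : 0 < unionLevel P k := by
  unfold unionLevel; positivity

/-- The deviation `u = √k + √n t_k` leaves a margin of order `k √(log p_n)`, which pays for the
covering cost `k log (7 + 6 u)`. -/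
theorem log_unionLevel_add_lt {P L u : ℝ} (hP : 0 < P) (hL : L = Real.log P) (hL100 : 100 ≤ L)
    {k : ℕ} (hk : 1 ≤ k) (hu : u = √k + √(6 * L + 2 * k * (L + 1))) :
    Real.log (unionLevel P k) ≤ u ^ 2 ∧
      Real.log (unionLevel P k) + k * Real.log (7 + 6 * u) < u ^ 2 / 2 - 2 := by
  have hk1 : (1 : ℝ) ≤ k := by exact_mod_cast hk
  have hf : (0 : ℝ) < k.factorial := by exact_mod_cast k.factorial_pos
  have hM : Real.log (unionLevel P k) = k * Real.log 2 + (k + 2) * L - Real.log k.factorial := by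
    rw [unionLevel, Real.log_div (by positivity) hf.ne', Real.log_mul (by positivity)
      (by positivity), Real.log_pow, Real.log_pow, ← hL]
    push_cast; ring
  have hf1 := log_factorial_ge hk
  have hf0 : 0 ≤ Real.log k.factorial := Real.log_nonneg (by exact_mod_cast k.factorial_pos)
  have hlk : 0 ≤ Real.log k := Real.log_nonneg hk1
  set s := √L with hs
  set c := √(k : ℝ) with hc
  have hs2 : s ^ 2 = L := Real.sq_sqrt (by linarith)
  have hc2 : c ^ 2 = k := Real.sq_sqrt (by linarith)
  have hs10 : 10 ≤ s := Real.le_sqrt_of_sq_le (by linarith)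
  have hc1 : 1 ≤ c := Real.le_sqrt_of_sq_le (by linarith)
  have hkL : L ≤ k * L := by nlinarith
  have hkk : (k : ℝ) ≤ k * L := by nlinarith
  set T := √(6 * L + 2 * k * (L + 1)) with hT
  have hT2 : T ^ 2 = 6 * L + 2 * k * (L + 1) := Real.sq_sqrt (by nlinarith)
  have hT0 : 0 ≤ T := Real.sqrt_nonneg _
  have hTlow : 14 / 10 * (c * s) ≤ T := by
    apply Real.le_sqrt_of_sq_le
    rw [mul_pow, mul_pow, hc2, hs2]
    nlinarith
  have hThigh : T ≤ 4 * (c * s) := by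
    rw [hT]
    apply Real.sqrt_le_iff.2
    refine ⟨by positivity, ?_⟩
    rw [mul_pow, mul_pow, hc2, hs2]
    nlinarith
  have hcs : c ≤ c * s := by nlinarith
  have hu2 : 3 * k + 6 * L + 2 * (k * L) + 28 / 10 * (k * s) ≤ u ^ 2 := by
    have h1 : c * (14 / 10 * (c * s)) ≤ c * T := mul_le_mul_of_nonneg_left hTlow (by linarith)
    have h2 : c * (14 / 10 * (c * s)) = 14 / 10 * (k * s) := by rw [← hc2]; ring
    rw [hu, add_sq, hT2, hc2]
    nlinarith
  have hu5 : u ≤ 5 * (c * s) := by rw [hu]; linarith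
  have hu0 : 0 < u := by rw [hu]; linarith
  have hlogu : Real.log (7 + 6 * u) ≤ 5 - Real.log 2 + Real.log k / 2 + (s - 1) := by
    have h1 : 7 + 6 * u ≤ 37 * (c * s) := by linarith
    have h2 : Real.log (37 * (c * s)) = Real.log 37 + (Real.log k / 2 + Real.log s) := by
      rw [Real.log_mul (by norm_num) (by positivity), Real.log_mul (by positivity) (by positivity),
        hc, Real.log_sqrt (by linarith)]
    have h3 : Real.log s ≤ s - 1 := Real.log_le_sub_one_of_pos (by linarith)
    have h4 : Real.log 37 + Real.log 2 ≤ 5 := by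
      rw [← Real.log_mul (by norm_num) (by norm_num), Real.log_le_iff_le_exp (by norm_num)]
      have h5 : Real.exp 5 = Real.exp 1 ^ 5 := by rw [← Real.exp_nat_mul]; norm_num
      rw [h5]
      have h6 : (2.7 : ℝ) ^ 5 ≤ Real.exp 1 ^ 5 :=
        pow_le_pow_left₀ (by norm_num) (by linarith [Real.exp_one_gt_d9]) 5
      norm_num at h6 ⊢
      linarith
    have h7 := Real.log_le_log (by linarith) h1
    linarith
  have hlog2 : Real.log 2 ≤ 1 := by linarith [Real.log_two_lt_d9]
  have hlog20 : 0 ≤ Real.log 2 := Real.log_nonneg (by norm_num)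
  have hks : (0 : ℝ) ≤ k * s := by positivity
  have hk2 : k * Real.log 2 ≤ k := by nlinarith
  constructor
  · rw [hM]
    linarith
  · have h1 := mul_le_mul_of_nonneg_left hlogu (by linarith : (0 : ℝ) ≤ k)
    have h2 : k * Real.log k / 2 ≤ Real.log k.factorial + k := by
      have : 0 ≤ k * Real.log k := by positivity
      linarith
    have h3 : (k : ℝ) * 10 ≤ k * s := mul_le_mul_of_nonneg_left hs10 (by linarith)
    rw [hM]
    linarith

/-- Vectors supported in `A` and orthogonal to all `q_j`. -/
def sparseComplement {p m : ℕ} (q : Fin m → EuclideanSpace ℝ (Fin p)) (A : Finset (Fin p)) :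
    Submodule ℝ (EuclideanSpace ℝ (Fin p)) where
  carrier := {v | (∀ ν, ν ∉ A → v ν = 0) ∧ ∀ j, inner ℝ (q j) v = 0}
  add_mem' := by
    rintro v w ⟨h1, h2⟩ ⟨h3, h4⟩
    exact ⟨fun ν hν => by simp [h1 ν hν, h3 ν hν], fun j => by simp [inner_add_right, h2 j, h4 j]⟩
  zero_mem' := ⟨fun ν _ => rfl, fun j => inner_zero_right _⟩
  smul_mem' := by
    rintro c v ⟨h1, h2⟩
    exact ⟨fun ν hν => by simp [h1 ν hν], fun j => by simp [inner_smul_right, h2 j]⟩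

theorem finrank_sparseComplement_le {p m : ℕ} (q : Fin m → EuclideanSpace ℝ (Fin p))
    (A : Finset (Fin p)) : Module.finrank ℝ (sparseComplement q A) ≤ A.card := by
  let f : sparseComplement q A →ₗ[ℝ] (A → ℝ) :=
    { toFun := fun v ν => (v : EuclideanSpace ℝ (Fin p)) ν
      map_add' := fun v w => rfl
      map_smul' := fun c v => rfl }
  have hf : Function.Injective f := by
    intro v w h
    ext ν
    by_cases hν : ν ∈ A
    · exact congrFun h ⟨ν, hν⟩
    · rw [v.2.1 ν hν, w.2.1 ν hν]
  have := LinearMap.finrank_le_finrank_of_injective hf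
  simpa using this

/-- The quadratic form of a spiked covariance matrix. -/
theorem dotProduct_spiked_mulVec {p m : ℕ} (lam : Fin m → ℝ)
    (q : Fin m → EuclideanSpace ℝ (Fin p)) (v : EuclideanSpace ℝ (Fin p)) :
    v ⬝ᵥ ((∑ j, lam j ^ 2 • Matrix.vecMulVec (q j) (q j)) + 1 : Matrix (Fin p) (Fin p) ℝ).mulVec v
      = ∑ j, lam j ^ 2 * (inner ℝ (q j) v) ^ 2 + ‖v‖ ^ 2 := by
  rw [Matrix.add_mulVec, Matrix.one_mulVec, dotProduct_add, Matrix.sum_mulVec, dotProduct_sum]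
  congr 1
  · refine Finset.sum_congr rfl fun j _ => ?_
    rw [Matrix.smul_mulVec, dotProduct_smul, Matrix.vecMulVec_mulVec, smul_eq_mul]
    congr 1
    have : inner ℝ (q j) v = v ⬝ᵥ q j := by
      rw [EuclideanSpace.inner_eq_star_dotProduct]; simp
    rw [this, dotProduct_smul, dotProduct_comm (q j).ofLp]
    simp [pow_two]
  · rw [EuclideanSpace.real_norm_sq_eq, dotProduct]
    exact Finset.sum_congr rfl fun i _ => (pow_two _).symm

theorem posSemidef_spiked {p m : ℕ} (lam : Fin m → ℝ) (q : Fin m → EuclideanSpace ℝ (Fin p)) :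
    ((∑ j, lam j ^ 2 • Matrix.vecMulVec (q j) (q j)) + 1 :
      Matrix (Fin p) (Fin p) ℝ).PosSemidef := by
  refine Matrix.PosSemidef.add (Matrix.posSemidef_sum _ fun j _ => ?_) Matrix.PosSemidef.one
  refine Matrix.PosSemidef.smul ?_ (sq_nonneg _)
  simpa using Matrix.posSemidef_vecMulVec_self_star (q j).ofLp

theorem one_le_pn {p n : ℕ} (hn : 1 ≤ n) : 1 ≤ pn p n := by
  unfold pn; exact_mod_cast hn.trans (le_max_right _ _)

/-- The threshold `δ_k` in the form `(√n + u)²` of the deviation bound. -/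
theorem mul_one_add_deltaK {p n k : ℕ} (hn : 1 ≤ n) : (n : ℝ) * (1 + deltaK p n k) =
    (√n + (√k + √(6 * Real.log (pn p n) + 2 * k * (Real.log (pn p n) + 1)))) ^ 2 := by
  have hn0 : (0 : ℝ) < n := by exact_mod_cast hn
  have hL : 0 ≤ Real.log (pn p n) := Real.log_nonneg (one_le_pn hn)
  have h1 : √n * (√(k / n) + tK p n k) =
      √k + √(6 * Real.log (pn p n) + 2 * k * (Real.log (pn p n) + 1)) := by
    rw [mul_add, tK, ← Real.sqrt_mul hn0.le, ← Real.sqrt_mul hn0.le]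
    congr 2
    · field_simp
    · field_simp
  have h2 : √(n : ℝ) ^ 2 = n := Real.sq_sqrt hn0.le
  rw [← h1, deltaK]
  linear_combination (-(1 + (√(k / n) + tK p n k)) ^ 2) * h2

/-- The data for which, on some set `A` of coordinates, the sample covariance matrix exceeds
`1 + δ_{card A}` in a direction orthogonal to the spikes. -/
def noiseExceeds {p m : ℕ} (n : ℕ) (q : Fin m → EuclideanSpace ℝ (Fin p)) :
    Set (Fin n → EuclideanSpace ℝ (Fin p)) :=
  {x | ∃ A : Finset (Fin p), A.Nonempty ∧ ∃ v ∈ sparseComplement q A, ‖v‖ = 1 ∧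
    n * (1 + deltaK p n A.card) ≤ sampleForm x v}

/-- Union bound over all coordinate sets: the `p.choose k ≤ p_n ^ k / k!` sets of size `k`
contribute at most `2 ^ (1 - k) p_n⁻²`. -/
theorem sampleLaw_noiseExceeds_le {p m n : ℕ} (hn : 1 ≤ n) (lam : Fin m → ℝ)
    (q : Fin m → EuclideanSpace ℝ (Fin p)) (hL : 100 ≤ Real.log (pn p n)) :
    sampleLaw n ((∑ j, lam j ^ 2 • Matrix.vecMulVec (q j) (q j)) + 1) (noiseExceeds n q) ≤
      ENNReal.ofReal (4 * (pn p n ^ 2)⁻¹) := by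
  set Sig : Matrix (Fin p) (Fin p) ℝ := (∑ j, lam j ^ 2 • Matrix.vecMulVec (q j) (q j)) + 1
  set P := pn p n with hP
  have hP1 : 1 ≤ P := one_le_pn hn
  have hP0 : 0 < P := by linarith
  let bad : Finset (Fin p) → Set (Fin n → EuclideanSpace ℝ (Fin p)) := fun A =>
    {x | A.Nonempty ∧ ∃ v ∈ sparseComplement q A, ‖v‖ = 1 ∧
      n * (1 + deltaK p n A.card) ≤ sampleForm x v}
  have hbad : ∀ A, sampleLaw n Sig (bad A) ≤ ENNReal.ofReal (2 / unionLevel P A.card) := by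
    intro A
    rcases A.eq_empty_or_nonempty with rfl | hA
    · have : bad ∅ = ∅ := by ext x; simp [bad]
      rw [this]; simp
    · have hk : 1 ≤ A.card := hA.card_pos
      obtain ⟨h1, h2⟩ := log_unionLevel_add_lt hP0 rfl hL hk rfl
      have hk0 : (0 : ℝ) < A.card := by exact_mod_cast hk
      refine (measure_mono ?_).trans (sampleLaw_exists_large_le hn (posSemidef_spiked lam q)
        (sparseComplement q A) ?_ (finrank_sparseComplement_le q A) ?_
        (unionLevel_pos hP0 _) h1 h2)
      · rintro x ⟨-, v, hv, hv1, hx⟩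
        exact ⟨v, hv, hv1, by rwa [← mul_one_add_deltaK hn]⟩
      · intro v hv
        rw [dotProduct_spiked_mulVec, Finset.sum_eq_zero, zero_add]
        intro j _
        rw [hv.2 j]; ring
      · have : 0 < √(A.card : ℝ) := Real.sqrt_pos.2 hk0
        positivity
  have hsub : noiseExceeds n q ⊆ ⋃ A ∈ (Finset.univ : Finset (Fin p)).powerset, bad A := by
    rintro x ⟨A, hA⟩
    simp only [Set.mem_iUnion]
    exact ⟨A, by simp, hA⟩
  refine (measure_mono hsub).trans ((measure_biUnion_finset_le _ _).trans
    ((Finset.sum_le_sum fun A _ => hbad A).trans ?_))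
  rw [← ENNReal.ofReal_sum_of_nonneg fun A _ => (div_pos two_pos (unionLevel_pos hP0 _)).le]
  refine ENNReal.ofReal_le_ofReal ?_
  rw [Finset.sum_powerset_apply_card (fun k => 2 / unionLevel P k)]
  have hterm : ∀ k ∈ Finset.range ((Finset.univ : Finset (Fin p)).card + 1),
      ((Finset.univ : Finset (Fin p)).card.choose k) • (2 / unionLevel P k) ≤
        2 * (P ^ 2)⁻¹ * (1 / 2) ^ k := by
    intro k _
    have hf : (0 : ℝ) < k.factorial := by exact_mod_cast k.factorial_pos
    rw [Finset.card_univ, Fintype.card_fin, nsmul_eq_mul]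
    have h1 : (p.choose k : ℝ) ≤ P ^ k / k.factorial := by
      refine (Nat.choose_le_pow_div (α := ℝ) k p).trans ?_
      have : (p : ℝ) ≤ P := by
        rw [hP, pn]; exact_mod_cast le_max_left _ _
      gcongr
    calc (p.choose k : ℝ) * (2 / unionLevel P k)
        ≤ P ^ k / k.factorial * (2 / unionLevel P k) :=
          mul_le_mul_of_nonneg_right h1 (div_pos two_pos (unionLevel_pos hP0 _)).le
      _ = 2 * (P ^ 2)⁻¹ * (1 / 2) ^ k := by
          rw [unionLevel, div_pow]
          field_simp
          ring
  refine (Finset.sum_le_sum hterm).trans ?_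
  rw [← Finset.mul_sum]
  have h2 := sum_geometric_two_le ((Finset.univ : Finset (Fin p)).card + 1)
  have h3 : 0 ≤ 2 * (P ^ 2)⁻¹ := by positivity
  nlinarith

/-! ### Eigenvalues of the selected submatrix -/

section Eigenvalues

variable {ι : Type*} [Fintype ι] [DecidableEq ι] {M : Matrix ι ι ℝ}

/-- An orthonormal basis of eigenvectors in the order of `eigenvalues₀`. -/
theorem exists_orthonormalBasis_eigenvalues₀ (hM : M.IsHermitian) :
    ∃ b : OrthonormalBasis (Fin (Fintype.card ι)) ℝ (EuclideanSpace ℝ ι),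
      ∀ v : EuclideanSpace ℝ ι,
        v ⬝ᵥ M.mulVec v = ∑ j, hM.eigenvalues₀ j * (inner ℝ (b j) v) ^ 2 := by
  have hT := Matrix.isSymmetric_toEuclideanLin_iff.mpr hM
  refine ⟨hT.eigenvectorBasis finrank_euclideanSpace, fun v => ?_⟩
  set b := hT.eigenvectorBasis finrank_euclideanSpace
  have h1 : v ⬝ᵥ M.mulVec v = inner ℝ v (Matrix.toEuclideanLin M v) := by
    rw [EuclideanSpace.inner_eq_star_dotProduct, dotProduct_comm]
    simp [Matrix.toLpLin_apply]
  rw [h1, ← b.sum_inner_mul_inner]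
  refine Finset.sum_congr rfl fun j _ => ?_
  rw [← hT (b j) v, hT.apply_eigenvectorBasis, real_inner_comm]
  rw [RCLike.real_smul_eq_coe_smul (K := ℝ), inner_smul_left]
  simp only [RCLike.ofReal_real_eq_id, id_eq, conj_trivial]
  rw [pow_two, mul_left_comm]
  rfl

/-- One half of the Courant–Fischer principle: `m` linear constraints cannot push the quadratic
form below the `(m+1)`-st largest eigenvalue. -/
theorem exists_form_ge_eigenvalues₀ (hM : M.IsHermitian) {m : ℕ} (hm : m < Fintype.card ι)
    (f : EuclideanSpace ℝ ι →ₗ[ℝ] (Fin m → ℝ)) :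
    ∃ v : EuclideanSpace ℝ ι, v ≠ 0 ∧ f v = 0 ∧
      hM.eigenvalues₀ ⟨m, hm⟩ * ‖v‖ ^ 2 ≤ v ⬝ᵥ M.mulVec v := by
  obtain ⟨b, hb⟩ := exists_orthonormalBasis_eigenvalues₀ hM
  let F : EuclideanSpace ℝ ι →ₗ[ℝ]
      (Fin m → ℝ) × ((Finset.Ioi (⟨m, hm⟩ : Fin (Fintype.card ι))) → ℝ) :=
    f.prod (LinearMap.pi fun j => (innerSL ℝ (b j)).toLinearMap)
  have hlt : Module.finrank ℝ
      ((Fin m → ℝ) × ((Finset.Ioi (⟨m, hm⟩ : Fin (Fintype.card ι))) → ℝ)) <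
        Module.finrank ℝ (EuclideanSpace ℝ ι) := by
    simp only [Module.finrank_prod, Module.finrank_fintype_fun_eq_card, Fintype.card_fin,
      Fintype.card_coe, Fin.card_Ioi, finrank_euclideanSpace]
    omega
  obtain ⟨v, hv, hv0⟩ := Submodule.exists_mem_ne_zero_of_ne_bot
    (LinearMap.ker_ne_bot_of_finrank_lt hlt (f := F))
  rw [LinearMap.mem_ker] at hv
  have hv1 : f v = 0 := congrArg Prod.fst hv
  refine ⟨v, hv0, hv1, ?_⟩
  rw [hb v, ← b.sum_sq_inner_right v, Finset.mul_sum]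
  refine Finset.sum_le_sum fun j _ => ?_
  rcases le_or_gt j ⟨m, hm⟩ with hj | hj
  · exact mul_le_mul_of_nonneg_right (hM.eigenvalues₀_antitone hj) (sq_nonneg _)
  · have h2 : (inner ℝ (b j) v : ℝ) = 0 :=
      congrFun (congrArg Prod.snd hv) ⟨j, Finset.mem_Ioi.2 hj⟩
    rw [h2]; simp

/-- The other half of the Courant–Fischer principle: if the quadratic form is at least `t` on an
`(m+1)`-dimensional subspace, then the `(m+1)`-st largest eigenvalue is at least `t`. -/
theorem le_eigenvalues₀_of_form_ge (hM : M.IsHermitian) {m : ℕ}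
    (g : (Fin (m + 1) → ℝ) →ₗ[ℝ] EuclideanSpace ℝ ι) (hg : Function.Injective g) {t : ℝ}
    (ht : ∀ c, t * ‖g c‖ ^ 2 ≤ g c ⬝ᵥ M.mulVec (g c)) :
    ∃ hm : m < Fintype.card ι, t ≤ hM.eigenvalues₀ ⟨m, hm⟩ := by
  have hcard : m + 1 ≤ Fintype.card ι := by
    have := LinearMap.finrank_le_finrank_of_injective hg
    simpa using this
  refine ⟨hcard, ?_⟩
  obtain ⟨b, hb⟩ := exists_orthonormalBasis_eigenvalues₀ hM
  have hm : m < Fintype.card ι := hcard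
  let F : (Fin (m + 1) → ℝ) →ₗ[ℝ] ((Finset.Iio (⟨m, hm⟩ : Fin (Fintype.card ι))) → ℝ) :=
    (LinearMap.pi fun j : Finset.Iio (⟨m, hm⟩ : Fin (Fintype.card ι)) =>
      (innerSL ℝ (b j)).toLinearMap) ∘ₗ g
  have hlt : Module.finrank ℝ ((Finset.Iio (⟨m, hm⟩ : Fin (Fintype.card ι))) → ℝ) <
      Module.finrank ℝ (Fin (m + 1) → ℝ) := by
    simp only [Module.finrank_fintype_fun_eq_card, Fintype.card_fin, Fintype.card_coe,
      Fin.card_Iio]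
    omega
  obtain ⟨c, hc, hc0⟩ := Submodule.exists_mem_ne_zero_of_ne_bot
    (LinearMap.ker_ne_bot_of_finrank_lt hlt (f := F))
  rw [LinearMap.mem_ker] at hc
  have hv0 : g c ≠ 0 := fun h => hc0 (hg (by rw [h, map_zero]))
  have hpos : 0 < ‖g c‖ ^ 2 := by positivity
  refine le_of_mul_le_mul_right ((ht c).trans ?_) hpos
  rw [hb, ← b.sum_sq_inner_right (g c), Finset.mul_sum]
  refine Finset.sum_le_sum fun j _ => ?_
  rcases le_or_gt ⟨m, hm⟩ j with hj | hj
  · exact mul_le_mul_of_nonneg_right (hM.eigenvalues₀_antitone hj) (sq_nonneg _)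
  · have h2 : (inner ℝ (b j) (g c) : ℝ) = 0 := congrFun hc ⟨j, Finset.mem_Iio.2 hj⟩
    rw [h2]; simp

end Eigenvalues

theorem dotProduct_sampleCov_mulVec {n p : ℕ} (x : Fin n → EuclideanSpace ℝ (Fin p))
    (v : EuclideanSpace ℝ (Fin p)) :
    v ⬝ᵥ (sampleCov x).mulVec v = sampleForm x v / n := by
  rw [sampleCov, Matrix.smul_mulVec, dotProduct_smul, Matrix.sum_mulVec, dotProduct_sum,
    sampleForm, smul_eq_mul, div_mul_eq_mul_div, one_mul]
  congr 1
  refine Finset.sum_congr rfl fun j _ => ?_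
  rw [Matrix.vecMulVec_mulVec]
  have : inner ℝ (x j) v = v ⬝ᵥ x j := by
    rw [EuclideanSpace.inner_eq_star_dotProduct]; simp
  rw [this, dotProduct_smul, dotProduct_comm (x j).ofLp]
  simp [pow_two]

/-- Extension by zero of a vector indexed by `A`. -/
noncomputable def extendZero {p : ℕ} (A : Finset (Fin p)) :
    EuclideanSpace ℝ A →ₗ[ℝ] EuclideanSpace ℝ (Fin p) where
  toFun w := WithLp.toLp 2 fun ν => if h : ν ∈ A then w ⟨ν, h⟩ else 0
  map_add' v w := by
    ext ν
    by_cases h : ν ∈ A <;> simp [h]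
  map_smul' c v := by
    ext ν
    by_cases h : ν ∈ A <;> simp [h]

theorem extendZero_apply {p : ℕ} (A : Finset (Fin p)) (w : EuclideanSpace ℝ A) (ν : Fin p) :
    extendZero A w ν = if h : ν ∈ A then w ⟨ν, h⟩ else 0 :=
  rfl

theorem extendZero_apply_coe {p : ℕ} (A : Finset (Fin p)) (w : EuclideanSpace ℝ A) (ν : A) :
    extendZero A w ν = w ν := by
  rw [extendZero_apply, dif_pos ν.2]

theorem sum_extendZero {p : ℕ} (A : Finset (Fin p)) (w : EuclideanSpace ℝ A) (f : Fin p → ℝ) :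
    ∑ ν, f ν * extendZero A w ν = ∑ ν : A, f ν * w ν := by
  have h1 : ∑ ν : A, f ν * w ν = ∑ ν : A, f ν * extendZero A w ν :=
    Finset.sum_congr rfl fun ν _ => by rw [extendZero_apply_coe]
  rw [h1, Finset.sum_coe_sort A fun ν => f ν * extendZero A w ν]
  refine (Finset.sum_subset (Finset.subset_univ A) fun ν _ hν => ?_).symm
  rw [extendZero_apply, dif_neg hν, mul_zero]

theorem norm_extendZero {p : ℕ} (A : Finset (Fin p)) (w : EuclideanSpace ℝ A) :
    ‖extendZero A w‖ = ‖w‖ := by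
  have h : ‖extendZero A w‖ ^ 2 = ‖w‖ ^ 2 := by
    rw [EuclideanSpace.real_norm_sq_eq, EuclideanSpace.real_norm_sq_eq]
    simp_rw [pow_two]
    rw [sum_extendZero A w fun ν => extendZero A w ν]
    simp_rw [extendZero_apply_coe]
  exact (sq_eq_sq₀ (norm_nonneg _) (norm_nonneg _)).1 h

theorem dotProduct_submatrix_mulVec {p : ℕ} (A : Finset (Fin p)) (S : Matrix (Fin p) (Fin p) ℝ)
    (w : EuclideanSpace ℝ A) :
    w ⬝ᵥ (S.submatrix (Subtype.val : A → Fin p) Subtype.val).mulVec w =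
      extendZero A w ⬝ᵥ S.mulVec (extendZero A w) := by
  rw [dotProduct_comm, dotProduct_comm (extendZero A w).ofLp]
  simp only [dotProduct, Matrix.mulVec]
  rw [sum_extendZero A w fun ν => ∑ j, S ν j * extendZero A w j]
  refine Finset.sum_congr rfl fun ν _ => ?_
  rw [sum_extendZero A w fun j => S ν j]
  rfl

theorem deltaK_nonneg (p n k : ℕ) : 0 ≤ deltaK p n k := by
  have := Real.sqrt_nonneg ((k : ℝ) / n)
  have h2 : 0 ≤ tK p n k := Real.sqrt_nonneg _
  unfold deltaK; positivity

/-- Overestimating the number of spikes requires large noise in a direction orthogonal to all of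
them. -/
theorem mem_noiseExceeds_of_lt_hatM {p m n : ℕ} (hn : 1 ≤ n) (α : ℝ)
    (q : Fin m → EuclideanSpace ℝ (Fin p)) {x : Fin n → EuclideanSpace ℝ (Fin p)}
    (h : m < hatM α x) : x ∈ noiseExceeds n q := by
  have hn0 : (0 : ℝ) < n := by exact_mod_cast hn
  rw [hatM, Finset.lt_sup_iff] at h
  obtain ⟨j, hj, hmj⟩ := h
  rw [Finset.mem_filter, Finset.mem_Icc] at hj
  obtain ⟨⟨hj1, hj2⟩, hell⟩ := hj
  simp only [id_eq] at hmj
  set A := selected α x with hA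
  rw [ellB, dif_pos ⟨hj1, hj2⟩] at hell
  have hδ := deltaK_nonneg p n A.card
  set hM := (sampleCov_isHermitian x).submatrix (Subtype.val : A → Fin p)
  have hmA : m < Fintype.card A := by rw [Fintype.card_coe]; omega
  have h1 : 1 + deltaK p n A.card < hM.eigenvalues₀ ⟨m, hmA⟩ := by
    rcases lt_max_iff.1 hell with h2 | h2
    · refine h2.trans_le (hM.eigenvalues₀_antitone ?_)
      rw [Fin.le_def]
      show m ≤ j - 1
      omega
    · linarith
  obtain ⟨w, hw0, hfw, hw⟩ := exists_form_ge_eigenvalues₀ hM hmA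
    ((LinearMap.pi fun j => (innerSL ℝ (q j)).toLinearMap) ∘ₗ extendZero A)
  have hwn : 0 < ‖w‖ := norm_pos_iff.2 hw0
  refine ⟨A, Finset.card_pos.1 (by omega), (‖w‖⁻¹ : ℝ) • extendZero A w,
    Submodule.smul_mem _ _ ⟨fun ν hν => by simp [extendZero, hν], fun j => congrFun hfw j⟩, ?_, ?_⟩
  · rw [norm_smul, norm_extendZero, norm_inv, norm_norm, inv_mul_cancel₀ hwn.ne']
  · rw [dotProduct_submatrix_mulVec, dotProduct_sampleCov_mulVec] at hw
    have h3 : sampleForm x ((‖w‖⁻¹ : ℝ) • extendZero A w) =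
        (‖w‖ ^ 2)⁻¹ * sampleForm x (extendZero A w) := by
      simp only [sampleForm, inner_smul_right, mul_pow, Finset.mul_sum, inv_pow]
    have h4 : (1 + deltaK p n A.card) * ‖w‖ ^ 2 ≤ sampleForm x (extendZero A w) / n :=
      le_trans (mul_le_mul_of_nonneg_right h1.le (sq_nonneg _)) hw
    rw [le_div_iff₀ hn0] at h4
    rw [h3, le_inv_mul_iff₀ (by positivity)]
    linarith

/-- The estimate is at least `m + 1` if the sample covariance matrix exceeds the threshold on an
`(m+1)`-dimensional space of vectors supported in the selected set. -/
theorem lt_hatM_of_form_ge {p m n : ℕ} (hn : 1 ≤ n) {α : ℝ}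
    {x : Fin n → EuclideanSpace ℝ (Fin p)}
    (g : (Fin (m + 1) → ℝ) →ₗ[ℝ] EuclideanSpace ℝ (Fin p)) (hg : Function.Injective g)
    (hsupp : ∀ c ν, ν ∉ selected α x → g c ν = 0) {t : ℝ}
    (ht : 1 + deltaK p n (selected α x).card < t)
    (hform : ∀ c, n * t * ‖g c‖ ^ 2 ≤ sampleForm x (g c)) : m + 1 ≤ hatM α x := by
  have hn0 : (0 : ℝ) < n := by exact_mod_cast hn
  set A := selected α x with hA
  let R : EuclideanSpace ℝ (Fin p) →ₗ[ℝ] EuclideanSpace ℝ A :=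
    { toFun := fun v => WithLp.toLp 2 fun ν => v ν
      map_add' := fun v w => rfl
      map_smul' := fun c v => rfl }
  have hR : ∀ c, extendZero A (R (g c)) = g c := by
    intro c
    ext ν
    by_cases h : ν ∈ A
    · rw [extendZero_apply, dif_pos h]; rfl
    · rw [extendZero_apply, dif_neg h, hsupp c ν h]
  set hM := (sampleCov_isHermitian x).submatrix (Subtype.val : A → Fin p)
  obtain ⟨hm, hev⟩ := le_eigenvalues₀_of_form_ge hM (R ∘ₗ g) (t := t) (by
    intro c d hcd
    apply hg
    rw [← hR c, ← hR d]
    exact congrArg _ hcd) (by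
    intro c
    rw [dotProduct_submatrix_mulVec, ← norm_extendZero, LinearMap.comp_apply, hR,
      dotProduct_sampleCov_mulVec, le_div_iff₀ hn0]
    linarith [hform c])
  rw [Fintype.card_coe] at hm
  have hmem : m + 1 ∈ (Finset.Icc 1 A.card).filter fun j => 1 + deltaK p n A.card < ellB α x j := by
    rw [Finset.mem_filter, Finset.mem_Icc]
    refine ⟨⟨by omega, by omega⟩, ?_⟩
    have hm' : m + 1 ≤ (selected α x).card := hm
    rw [ellB, dif_pos ⟨by omega, hm'⟩]
    exact lt_max_of_lt_left (ht.trans_le hev)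
  exact Finset.le_sup (f := id) hmem

/-! ### Chi-square tails and the selection of coordinates -/

section ChiSquareTails

variable {n p : ℕ} {Sig : Matrix (Fin p) (Fin p) ℝ}

/-- Chernoff's bound for `v'Sv`; with `t < 0` it covers the lower tail. -/
theorem sampleLaw_exp_ge_le (hS : Sig.PosSemidef) (v : EuclideanSpace ℝ (Fin p)) {t σ : ℝ}
    (hσ : v ⬝ᵥ Sig.mulVec v = σ) (ht : 2 * t * σ < 1) (a : ℝ) :
    sampleLaw n Sig {x | a ≤ t * sampleForm x v} ≤
      ENNReal.ofReal (Real.exp (-a - n / 2 * Real.log (1 - 2 * t * σ))) := by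
  have hmeas : Measurable fun x : Fin n → EuclideanSpace ℝ (Fin p) =>
      ENNReal.ofReal (Real.exp (t * sampleForm x v)) := by
    unfold sampleForm; fun_prop
  have h := mul_meas_ge_le_lintegral₀ (μ := sampleLaw n Sig) hmeas.aemeasurable
    (ENNReal.ofReal (Real.exp a))
  rw [lintegral_exp_sampleForm hS v hσ ht] at h
  have h1 : {x : Fin n → EuclideanSpace ℝ (Fin p) | a ≤ t * sampleForm x v} =
      {x | ENNReal.ofReal (Real.exp a) ≤ ENNReal.ofReal (Real.exp (t * sampleForm x v))} := by
    ext x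
    rw [Set.mem_ofPred_eq, Set.mem_ofPred_eq, ENNReal.ofReal_le_ofReal_iff (Real.exp_pos _).le,
      Real.exp_le_exp]
  rw [h1]
  have h2 : Real.exp (-a - n / 2 * Real.log (1 - 2 * t * σ)) =
      (Real.exp a)⁻¹ * Real.exp (-(n / 2) * Real.log (1 - 2 * t * σ)) := by
    rw [← Real.exp_neg, ← Real.exp_add]; congr 1; ring
  rw [h2, ENNReal.ofReal_mul (by positivity), ENNReal.ofReal_inv_of_pos (Real.exp_pos _)]
  rw [mul_comm] at h
  rw [mul_comm, ← div_eq_mul_inv]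
  exact (ENNReal.le_div_iff_mul_le (Or.inl (by simp [Real.exp_pos]))
    (Or.inl ENNReal.ofReal_ne_top)).2 h

/-- Upper tail of `σ χ²_n`. -/
theorem sampleLaw_form_ge_le (hS : Sig.PosSemidef) (v : EuclideanSpace ℝ (Fin p)) {t σ : ℝ}
    (hσ : v ⬝ᵥ Sig.mulVec v = σ) (hσ0 : 0 < σ) (ht0 : 0 ≤ t) (ht : t ≤ 1 / 2) :
    sampleLaw n Sig {x | n * (σ * (1 + t)) ≤ sampleForm x v} ≤
      ENNReal.ofReal (Real.exp (-(n * t ^ 2 / 4 * (1 - 4 * t)))) := by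
  have hts : 2 * (t / (2 * σ)) * σ = t := by field_simp
  have h := sampleLaw_exp_ge_le (n := n) hS v (t := t / (2 * σ)) hσ (by rw [hts]; linarith)
    (n * t * (1 + t) / 2)
  rw [hts] at h
  refine (measure_mono ?_).trans (h.trans (ENNReal.ofReal_le_ofReal (Real.exp_le_exp.2 ?_)))
  · intro x hx
    rw [Set.mem_ofPred_eq] at hx ⊢
    have h1 := mul_le_mul_of_nonneg_left hx (show 0 ≤ t / (2 * σ) by positivity)
    refine le_trans (le_of_eq ?_) h1
    field_simp
  · have h3 := Real.abs_log_sub_add_sum_range_le (x := t) (by rw [abs_of_nonneg ht0]; linarith) 2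
    simp only [Finset.sum_range_succ, Finset.range_zero, Finset.sum_empty, zero_add, pow_one,
      Nat.cast_zero, div_one, Nat.cast_one, abs_of_nonneg ht0] at h3
    have h4 : t ^ (2 + 1) / (1 - t) ≤ 2 * t ^ 3 := by
      rw [div_le_iff₀ (by linarith)]
      have h8 : t ^ 3 * (1 / 2) ≤ t ^ 3 * (1 - t) :=
        mul_le_mul_of_nonneg_left (by linarith) (by positivity)
      have h9 : t ^ (2 + 1) = t ^ 3 := rfl
      rw [h9]
      linarith
    have h5 := (abs_le.1 (h3.trans h4)).1
    norm_num at h5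
    have hn : (0 : ℝ) ≤ n / 2 := by positivity
    have h6 : -t - t ^ 2 / 2 - 2 * t ^ 3 ≤ Real.log (1 - t) := by linarith
    have h7 := mul_le_mul_of_nonneg_left h6 hn
    linarith

/-- Lower tail of `σ χ²_n`. -/
theorem sampleLaw_form_le_le (hS : Sig.PosSemidef) (v : EuclideanSpace ℝ (Fin p)) {t σ : ℝ}
    (hσ : v ⬝ᵥ Sig.mulVec v = σ) (hσ0 : 0 < σ) (ht0 : 0 ≤ t) :
    sampleLaw n Sig {x | sampleForm x v ≤ n * (σ * (1 - t))} ≤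
      ENNReal.ofReal (Real.exp (-(n * t ^ 2 / 4))) := by
  have hts : 2 * (-t / (2 * σ)) * σ = -t := by field_simp
  have h := sampleLaw_exp_ge_le (n := n) hS v (t := -t / (2 * σ)) hσ (by rw [hts]; linarith)
    (-(n * t * (1 - t) / 2))
  rw [hts] at h
  refine (measure_mono ?_).trans (h.trans (ENNReal.ofReal_le_ofReal (Real.exp_le_exp.2 ?_)))
  · intro x hx
    rw [Set.mem_ofPred_eq] at hx ⊢
    have h1 := mul_le_mul_of_nonneg_left hx (show 0 ≤ t / (2 * σ) by positivity)
    have h2 : t / (2 * σ) * (n * (σ * (1 - t))) = n * t * (1 - t) / 2 := by field_simp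
    rw [h2] at h1
    rw [neg_div, neg_mul]
    linarith
  · have h3 : t - t ^ 2 / 2 ≤ Real.log (1 + t) := by
      refine le_trans ?_ (Real.le_log_one_add_of_nonneg ht0)
      rw [le_div_iff₀ (by linarith)]
      nlinarith [pow_nonneg ht0 3]
    have hn : (0 : ℝ) ≤ n / 2 := by positivity
    have h7 := mul_le_mul_of_nonneg_left h3 hn
    rw [sub_neg_eq_add]
    linarith

end ChiSquareTails

theorem exp_neg_le_inv_pow {P a : ℝ} (hP : 0 < P) (ha : 3 * Real.log P ≤ a) :
    Real.exp (-a) ≤ (P ^ 3)⁻¹ := by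
  rw [← Real.exp_log (show 0 < P ^ 3 by positivity), ← Real.exp_neg, Real.exp_le_exp,
    Real.log_pow]
  push_cast
  linarith

theorem sampleForm_single {n p : ℕ} (x : Fin n → EuclideanSpace ℝ (Fin p)) (ν : Fin p)
    (hn : 1 ≤ n) : sampleForm x (EuclideanSpace.single ν 1) = n * sampleCov x ν ν := by
  have hn0 : (n : ℝ) ≠ 0 := by positivity
  have h := dotProduct_sampleCov_mulVec x (EuclideanSpace.single ν 1)
  have h2 : (EuclideanSpace.single ν (1 : ℝ)).ofLp ⬝ᵥ
      (sampleCov x).mulVec (EuclideanSpace.single ν (1 : ℝ)).ofLp = sampleCov x ν ν := by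
    simp
  rw [h2] at h
  rw [h]; field_simp

/-- The data for which the selected set contains a coordinate of small variance or misses a
coordinate of large variance. -/
def selectionFails {n p : ℕ} (α a b : ℝ) (Sig : Matrix (Fin p) (Fin p) ℝ) :
    Set (Fin n → EuclideanSpace ℝ (Fin p)) :=
  {x | ∃ ν, (Sig ν ν < 1 + a ∧ ν ∈ selected α x) ∨ (1 + b ≤ Sig ν ν ∧ ν ∉ selected α x)}

/-- If `(1 + a) (1 + t) ≤ 1 + α_n`, the selection of a coordinate with variance below `1 + a` needs
a relative deviation `t`; missing one with variance above `1 + 3 α_n` needs a relative deviation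
`α_n` since `(1 + 3 α_n) (1 - α_n) ≥ 1 + α_n`. -/
theorem sampleLaw_selectionFails_le {n p : ℕ} (hn : 1 ≤ n) {Sig : Matrix (Fin p) (Fin p) ℝ}
    (hS : Sig.PosSemidef) (hS1 : ∀ ν, 1 ≤ Sig ν ν) {α a t : ℝ} (ht0 : 0 ≤ t)
    (ht : t ≤ 1 / 2) (hat : (1 + a) * (1 + t) ≤ 1 + alphaN α p n)
    (htL : 3 * Real.log (pn p n) ≤ n * t ^ 2 / 4 * (1 - 4 * t))
    (hα0 : 0 ≤ alphaN α p n) (hα : alphaN α p n ≤ 1 / 3)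
    (hαL : 3 * Real.log (pn p n) ≤ n * alphaN α p n ^ 2 / 4) :
    sampleLaw n Sig (selectionFails α a (3 * alphaN α p n) Sig) ≤
      ENNReal.ofReal (2 * (pn p n ^ 2)⁻¹) := by
  have hn0 : (0 : ℝ) < n := by exact_mod_cast hn
  have hP := one_le_pn (p := p) hn
  have hP0 : 0 < pn p n := by linarith
  have hmem : ∀ (x : Fin n → EuclideanSpace ℝ (Fin p)) ν, ν ∈ selected α x ↔
      n * (1 + alphaN α p n) ≤ sampleForm x (EuclideanSpace.single ν 1) := by
    intro x ν
    rw [sampleForm_single x ν hn, mul_le_mul_iff_right₀ hn0]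
    simp [selected]
  have hσ : ∀ ν, (EuclideanSpace.single ν (1 : ℝ)).ofLp ⬝ᵥ
      Sig.mulVec (EuclideanSpace.single ν (1 : ℝ)).ofLp = Sig ν ν := fun ν => by simp
  let bad : Fin p → Set (Fin n → EuclideanSpace ℝ (Fin p)) := fun ν =>
    {x | (Sig ν ν < 1 + a ∧ ν ∈ selected α x) ∨
      (1 + 3 * alphaN α p n ≤ Sig ν ν ∧ ν ∉ selected α x)}
  have hbad : ∀ ν, sampleLaw n Sig (bad ν) ≤ ENNReal.ofReal (2 * (pn p n ^ 3)⁻¹) := by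
    intro ν
    have hpos : 0 < Sig ν ν := by linarith [hS1 ν]
    have h2 : ENNReal.ofReal (2 * (pn p n ^ 3)⁻¹) =
        ENNReal.ofReal (pn p n ^ 3)⁻¹ + ENNReal.ofReal (pn p n ^ 3)⁻¹ := by
      rw [← ENNReal.ofReal_add (by positivity) (by positivity), two_mul]
    have hsub : bad ν ⊆ {x | Sig ν ν < 1 + a ∧ ν ∈ selected α x} ∪
        {x | 1 + 3 * alphaN α p n ≤ Sig ν ν ∧ ν ∉ selected α x} := fun x hx => hx
    rw [h2]
    refine (measure_mono hsub).trans ((measure_union_le _ _).trans (add_le_add ?_ ?_))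
    · refine le_trans (measure_mono ?_) ((sampleLaw_form_ge_le hS _ (hσ ν) hpos ht0 ht).trans
        (ENNReal.ofReal_le_ofReal (exp_neg_le_inv_pow hP0 htL)))
      rintro x ⟨h3, h4⟩
      rw [hmem] at h4
      refine le_trans (mul_le_mul_of_nonneg_left (le_trans ?_ hat) hn0.le) h4
      exact mul_le_mul_of_nonneg_right h3.le (by linarith)
    · refine le_trans (measure_mono ?_) ((sampleLaw_form_le_le hS _ (hσ ν) hpos hα0).trans
        (ENNReal.ofReal_le_ofReal (exp_neg_le_inv_pow hP0 hαL)))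
      rintro x ⟨h3, h4⟩
      rw [hmem, not_le] at h4
      refine h4.le.trans (mul_le_mul_of_nonneg_left ?_ hn0.le)
      have := mul_le_mul_of_nonneg_right h3 (show 0 ≤ 1 - alphaN α p n by linarith)
      nlinarith
  have hsub : selectionFails α a (3 * alphaN α p n) Sig ⊆
      ⋃ ν ∈ (Finset.univ : Finset (Fin p)), bad ν := by
    rintro x ⟨ν, hν⟩
    simp only [Set.mem_iUnion]
    exact ⟨ν, Finset.mem_univ _, hν⟩
  refine (measure_mono hsub).trans ((measure_biUnion_finset_le _ _).trans
    ((Finset.sum_le_sum fun ν _ => hbad ν).trans ?_))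
  rw [← ENNReal.ofReal_sum_of_nonneg fun _ _ => by positivity]
  refine ENNReal.ofReal_le_ofReal ?_
  rw [Finset.sum_const, Finset.card_univ, Fintype.card_fin, nsmul_eq_mul]
  have h5 : (p : ℝ) ≤ pn p n := by unfold pn; exact_mod_cast le_max_left _ _
  calc (p : ℝ) * (2 * (pn p n ^ 3)⁻¹) ≤ pn p n * (2 * (pn p n ^ 3)⁻¹) :=
        mul_le_mul_of_nonneg_right h5 (by positivity)
    _ = 2 * (pn p n ^ 2)⁻¹ := by field_simp

/-- The data for which the sample variance in one of the directions `w i` deviates from the true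
variance by more than the proportion `t`. -/
def varianceDeviates {n p : ℕ} {ι : Type*} (t : ℝ) (Sig : Matrix (Fin p) (Fin p) ℝ)
    (w : ι → EuclideanSpace ℝ (Fin p)) : Set (Fin n → EuclideanSpace ℝ (Fin p)) :=
  {x | ∃ i, n * (t * (w i ⬝ᵥ Sig.mulVec (w i))) <
    |sampleForm x (w i) - n * (w i ⬝ᵥ Sig.mulVec (w i))|}

theorem sampleLaw_varianceDeviates_le {n p : ℕ} (hn : 1 ≤ n) {ι : Type*} [Fintype ι]
    {Sig : Matrix (Fin p) (Fin p) ℝ} (hS : Sig.PosSemidef)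
    (w : ι → EuclideanSpace ℝ (Fin p)) (hw : ∀ i, w i = 0 ∨ 0 < w i ⬝ᵥ Sig.mulVec (w i))
    {t : ℝ} (ht0 : 0 ≤ t) (ht : t ≤ 1 / 2)
    (htL : 3 * Real.log (pn p n) ≤ n * t ^ 2 / 4 * (1 - 4 * t))
    (hcard : 2 * (Fintype.card ι : ℝ) ≤ pn p n) :
    sampleLaw n Sig (varianceDeviates t Sig w) ≤ ENNReal.ofReal ((pn p n ^ 2)⁻¹) := by
  have hn0 : (0 : ℝ) < n := by exact_mod_cast hn
  have hP := one_le_pn (p := p) hn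
  have hP0 : 0 < pn p n := by linarith
  let bad : ι → Set (Fin n → EuclideanSpace ℝ (Fin p)) := fun i =>
    {x | n * (t * (w i ⬝ᵥ Sig.mulVec (w i))) <
      |sampleForm x (w i) - n * (w i ⬝ᵥ Sig.mulVec (w i))|}
  have hbad : ∀ i, sampleLaw n Sig (bad i) ≤ ENNReal.ofReal (2 * (pn p n ^ 3)⁻¹) := by
    intro i
    rcases hw i with h0 | hpos
    · have : bad i = ∅ := by
        ext x
        simp [bad, h0, sampleForm]
      rw [this]; simp
    · have h2 : ENNReal.ofReal (2 * (pn p n ^ 3)⁻¹) =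
          ENNReal.ofReal (pn p n ^ 3)⁻¹ + ENNReal.ofReal (pn p n ^ 3)⁻¹ := by
        rw [← ENNReal.ofReal_add (by positivity) (by positivity), two_mul]
      have htL' : 3 * Real.log (pn p n) ≤ n * t ^ 2 / 4 := by
        have : 0 ≤ n * t ^ 2 / 4 * (4 * t) := by positivity
        linarith
      rw [h2]
      refine (measure_mono (t := {x | n * ((w i ⬝ᵥ Sig.mulVec (w i)) * (1 + t)) ≤
        sampleForm x (w i)} ∪ {x | sampleForm x (w i) ≤
          n * ((w i ⬝ᵥ Sig.mulVec (w i)) * (1 - t))}) ?_).trans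
        ((measure_union_le _ _).trans (add_le_add
          ((sampleLaw_form_ge_le hS _ rfl hpos ht0 ht).trans
            (ENNReal.ofReal_le_ofReal (exp_neg_le_inv_pow hP0 htL)))
          ((sampleLaw_form_le_le hS _ rfl hpos ht0).trans
            (ENNReal.ofReal_le_ofReal (exp_neg_le_inv_pow hP0 htL')))))
      intro x hx
      have hx' : n * (t * (w i ⬝ᵥ Sig.mulVec (w i))) <
          |sampleForm x (w i) - n * (w i ⬝ᵥ Sig.mulVec (w i))| := hx
      rcases lt_abs.1 hx' with h3 | h3
      · left; rw [Set.mem_ofPred_eq]; linarith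
      · right; rw [Set.mem_ofPred_eq]; linarith
  have hsub : varianceDeviates t Sig w ⊆ ⋃ i ∈ (Finset.univ : Finset ι), bad i := by
    rintro x ⟨i, hi⟩
    simp only [Set.mem_iUnion]
    exact ⟨i, Finset.mem_univ _, hi⟩
  refine (measure_mono hsub).trans ((measure_biUnion_finset_le _ _).trans
    ((Finset.sum_le_sum fun i _ => hbad i).trans ?_))
  rw [← ENNReal.ofReal_sum_of_nonneg fun _ _ => by positivity]
  refine ENNReal.ofReal_le_ofReal ?_
  rw [Finset.sum_const, Finset.card_univ, nsmul_eq_mul]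
  calc (Fintype.card ι : ℝ) * (2 * (pn p n ^ 3)⁻¹)
      = (2 * (Fintype.card ι : ℝ)) * (pn p n ^ 3)⁻¹ := by ring
    _ ≤ pn p n * (pn p n ^ 3)⁻¹ := mul_le_mul_of_nonneg_right hcard (by positivity)
    _ = (pn p n ^ 2)⁻¹ := by field_simp

/-! ### Weak `ℓ_r` balls -/

/-- In the weak `ℓ_r` ball of radius `s`, at most `(s / τ) ^ r` coordinates reach `τ` in absolute
value. -/
theorem WeakBall.card_le {r s τ : ℝ} (hr : 0 < r) (hs : 0 < s) (hτ : 0 < τ) {p : ℕ}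
    {u : EuclideanSpace ℝ (Fin p)} (hu : WeakBall r s u) :
    ((Finset.univ.filter fun ν => τ ≤ |u ν|).card : ℝ) ≤ s ^ r * τ ^ (-r) := by
  set σ := Tuple.sort (fun i => -|u i|)
  have h1 : (Finset.univ.filter fun ν => τ ≤ |u ν|).card =
      (Finset.univ.filter fun i => τ ≤ absOrdered u i).card := by
    refine (Finset.card_bij (fun i _ => σ i) ?_ ?_ ?_).symm
    · intro i hi
      exact Finset.mem_filter.2 ⟨Finset.mem_univ _, (Finset.mem_filter.1 hi).2⟩
    · intro i _ j _ h
      exact σ.injective h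
    · intro ν hν
      refine ⟨σ.symm ν, ?_, by simp⟩
      refine Finset.mem_filter.2 ⟨Finset.mem_univ _, ?_⟩
      change τ ≤ |u (σ (σ.symm ν))|
      rw [σ.apply_symm_apply]
      exact (Finset.mem_filter.1 hν).2
  rw [h1]
  set X := s ^ r * τ ^ (-r) with hX
  have hX0 : 0 ≤ X := by positivity
  have h2 : ∀ i ∈ Finset.univ.filter fun i => τ ≤ absOrdered u i, (i : ℕ) ∈ Finset.range ⌊X⌋₊ := by
    intro i hi
    have h3 : τ ≤ absOrdered u i := by simpa using hi
    have h4 := h3.trans (hu i)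
    have hi0 : (0 : ℝ) < (i : ℝ) + 1 := by positivity
    have h5 : τ ^ r ≤ s ^ r * ((i : ℝ) + 1)⁻¹ := by
      have := Real.rpow_le_rpow hτ.le h4 hr.le
      rw [Real.mul_rpow hs.le (by positivity), ← Real.rpow_mul hi0.le,
        show -1 / r * r = -1 by field_simp, Real.rpow_neg_one] at this
      exact this
    have h6 : (((i : ℕ) + 1 : ℕ) : ℝ) ≤ X := by
      push_cast
      rw [← div_eq_mul_inv, le_div_iff₀ hi0] at h5
      rw [hX, Real.rpow_neg hτ.le, ← div_eq_mul_inv, le_div_iff₀ (by positivity)]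
      linarith
    rw [Finset.mem_range]
    exact Nat.lt_of_succ_le (Nat.le_floor h6)
  have h7 := Finset.card_le_card_of_injOn (fun i : Fin p => (i : ℕ)) h2
    (fun a _ b _ h => Fin.ext h)
  rw [Finset.card_range] at h7
  exact (Nat.cast_le.2 h7).trans (Nat.floor_le hX0)

theorem min_sq_eq_setIntegral {τ c : ℝ} (hτ : 0 ≤ τ) (hc : 0 ≤ c) :
    min c τ ^ 2 = ∫ t in Set.Ioc 0 τ, (Set.Iic c).indicator (fun t => 2 * t) t := by
  rw [setIntegral_indicator measurableSet_Iic]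
  have h1 : Set.Ioc 0 τ ∩ Set.Iic c = Set.Ioc 0 (min c τ) := by
    ext t; simp only [Set.mem_inter_iff, Set.mem_Ioc, Set.mem_Iic, le_min_iff]; tauto
  rw [h1, ← intervalIntegral.integral_of_le (le_min hc hτ), intervalIntegral.integral_const_mul,
    integral_id]
  ring

/-- Truncated squared norm of a vector in the weak `ℓ_r` ball, by summing the counts of large
coordinates over all levels. -/
theorem WeakBall.sum_min_sq_le {r s τ : ℝ} (hr : 0 < r) (hr2 : r < 2) (hs : 0 < s) (hτ : 0 ≤ τ)
    {p : ℕ} {u : EuclideanSpace ℝ (Fin p)} (hu : WeakBall r s u) :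
    ∑ ν, min |u ν| τ ^ 2 ≤ 2 / (2 - r) * (s ^ r * τ ^ (2 - r)) := by
  simp_rw [fun ν => min_sq_eq_setIntegral hτ (abs_nonneg (u ν))]
  have hint : ∀ ν, IntegrableOn (fun t => (Set.Iic |u ν|).indicator (fun t => 2 * t) t)
      (Set.Ioc 0 τ) := by
    intro ν
    refine Integrable.indicator ?_ measurableSet_Iic
    exact (Continuous.integrableOn_Icc (by fun_prop)).mono_set Set.Ioc_subset_Icc_self
  have hrp : IntervalIntegrable (fun t : ℝ => t ^ (1 - r)) volume 0 τ :=
    intervalIntegral.intervalIntegrable_rpow' (by linarith)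
  have hrp' : IntegrableOn (fun t : ℝ => 2 * s ^ r * t ^ (1 - r)) (Set.Ioc 0 τ) :=
    ((intervalIntegrable_iff_integrableOn_Ioc_of_le hτ).1 hrp).const_mul _
  rw [← integral_finsetSum _ fun ν _ => hint ν]
  calc ∫ t in Set.Ioc 0 τ, ∑ ν, (Set.Iic |u ν|).indicator (fun t => 2 * t) t
      ≤ ∫ t in Set.Ioc 0 τ, 2 * s ^ r * t ^ (1 - r) := by
        refine setIntegral_mono_on (integrable_finsetSum _ fun ν _ => hint ν) hrp'
          measurableSet_Ioc fun t ht => ?_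
        have h1 : ∑ ν, (Set.Iic |u ν|).indicator (fun t => 2 * t) t =
            ((Finset.univ.filter fun ν => t ≤ |u ν|).card : ℝ) * (2 * t) := by
          rw [← nsmul_eq_mul, ← Finset.sum_const, Finset.sum_filter]
          rfl
        rw [h1]
        have h2 := mul_le_mul_of_nonneg_right (hu.card_le hr hs ht.1)
          (show 0 ≤ 2 * t by linarith [ht.1])
        refine h2.trans (le_of_eq ?_)
        rw [sub_eq_neg_add, Real.rpow_add ht.1, Real.rpow_one]
        ring
    _ = 2 / (2 - r) * (s ^ r * τ ^ (2 - r)) := by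
        rw [← intervalIntegral.integral_of_le hτ, intervalIntegral.integral_const_mul,
          integral_rpow (Or.inl (by linarith)), show 1 - r + 1 = 2 - r by ring,
          Real.zero_rpow (by linarith)]
        have : 2 - r ≠ 0 := by linarith
        field_simp
        ring

/-! ### Truncated spikes -/

/-- The coordinate projection that keeps the coordinates in `A` and sets the others to zero. -/
noncomputable def coordProj {p : ℕ} (A : Finset (Fin p)) :
    EuclideanSpace ℝ (Fin p) →ₗ[ℝ] EuclideanSpace ℝ (Fin p) where
  toFun u := WithLp.toLp 2 fun ν => if ν ∈ A then u ν else 0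
  map_add' u v := by
    ext ν
    by_cases h : ν ∈ A <;> simp [h]
  map_smul' c u := by
    ext ν
    by_cases h : ν ∈ A <;> simp [h]

section CoordProj

variable {p : ℕ} (A : Finset (Fin p)) (u : EuclideanSpace ℝ (Fin p))

theorem coordProj_apply (ν : Fin p) : coordProj A u ν = if ν ∈ A then u ν else 0 := rfl

theorem inner_coordProj_self : inner ℝ u (coordProj A u) = ‖coordProj A u‖ ^ 2 := by
  rw [EuclideanSpace.real_norm_sq_eq, EuclideanSpace.inner_eq_star_dotProduct]
  simp only [dotProduct, star_trivial, coordProj_apply]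
  refine Finset.sum_congr rfl fun ν _ => ?_
  split_ifs <;> ring

theorem norm_sub_coordProj_sq : ‖u - coordProj A u‖ ^ 2 = ∑ ν ∈ Aᶜ, u ν ^ 2 := by
  rw [EuclideanSpace.real_norm_sq_eq, ← Finset.sum_subset (Finset.subset_univ Aᶜ)]
  · refine Finset.sum_congr rfl fun ν hν => ?_
    rw [PiLp.sub_apply, coordProj_apply, if_neg (Finset.mem_compl.1 hν), sub_zero]
  · intro ν _ hν
    rw [PiLp.sub_apply, coordProj_apply, if_pos (by simpa using hν), sub_self]
    ring

theorem norm_coordProj_sq : ‖coordProj A u‖ ^ 2 = ‖u‖ ^ 2 - ‖u - coordProj A u‖ ^ 2 := by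
  rw [norm_sub_sq_real, inner_coordProj_self]; ring

theorem norm_coordProj_le : ‖coordProj A u‖ ≤ ‖u‖ := by
  have := norm_coordProj_sq A u
  exact (sq_le_sq₀ (norm_nonneg _) (norm_nonneg _)).1 (by linarith [sq_nonneg ‖u - coordProj A u‖])

end CoordProj

/-- Polarisation: control of a symmetric bilinear form on the sums `v a + v b` controls it on the
span of the `v a`. -/
theorem abs_bilin_sum_le {E ι : Type*} [AddCommGroup E] [Module ℝ E] [Fintype ι]
    (B : E →ₗ[ℝ] E →ₗ[ℝ] ℝ) (hsym : ∀ u v, B u v = B v u) (v : ι → E) {K : ℝ}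
    (hK : ∀ a b, |B (v a + v b) (v a + v b)| ≤ 4 * K) (c : ι → ℝ) :
    |B (∑ a, c a • v a) (∑ a, c a • v a)| ≤ 3 * K * (Fintype.card ι * ∑ a, c a ^ 2) := by
  have h1 : ∀ a, |B (v a) (v a)| ≤ K := by
    intro a
    have h := hK a a
    have h2 : B (v a + v a) (v a + v a) = 4 * B (v a) (v a) := by
      simp only [map_add, LinearMap.add_apply]; ring
    rw [h2, abs_mul, abs_of_pos (by norm_num : (0 : ℝ) < 4)] at h
    linarith
  have h3 : ∀ a b, |B (v a) (v b)| ≤ 3 * K := by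
    intro a b
    have h := abs_le.1 (hK a b)
    have ha := abs_le.1 (h1 a)
    have hb := abs_le.1 (h1 b)
    have h2 : B (v a + v b) (v a + v b) = B (v a) (v a) + 2 * B (v a) (v b) + B (v b) (v b) := by
      simp only [map_add, LinearMap.add_apply, hsym (v b) (v a)]; ring
    rw [h2] at h
    rw [abs_le]; constructor <;> linarith
  have h4 : B (∑ a, c a • v a) (∑ a, c a • v a) = ∑ a, ∑ b, c a * (c b * B (v a) (v b)) := by
    simp only [map_sum, LinearMap.sum_apply, map_smul, LinearMap.smul_apply, smul_eq_mul,
      Finset.mul_sum]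
    rw [Finset.sum_comm]
    refine Finset.sum_congr rfl fun a _ => Finset.sum_congr rfl fun b _ => ?_
    ring
  have hK0 : ∀ _ : ι, 0 ≤ K := fun a => (abs_nonneg _).trans (h1 a)
  calc |B (∑ a, c a • v a) (∑ a, c a • v a)|
      ≤ ∑ a, ∑ b, |c a| * (|c b| * (3 * K)) := by
        rw [h4]
        refine (Finset.abs_sum_le_sum_abs _ _).trans (Finset.sum_le_sum fun a _ =>
          (Finset.abs_sum_le_sum_abs _ _).trans (Finset.sum_le_sum fun b _ => ?_))
        rw [abs_mul, abs_mul]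
        exact mul_le_mul_of_nonneg_left (mul_le_mul_of_nonneg_left (h3 a b) (abs_nonneg _))
          (abs_nonneg _)
    _ = 3 * K * (∑ a, |c a|) ^ 2 := by
        simp_rw [← Finset.mul_sum, ← Finset.sum_mul]
        ring
    _ ≤ 3 * K * (Fintype.card ι * ∑ a, c a ^ 2) := by
        rcases isEmpty_or_nonempty ι with hι | ⟨⟨a₀⟩⟩
        · simp
        · have := sq_sum_le_card_mul_sum_sq (s := Finset.univ) (f := fun a => |c a|)
          simp only [sq_abs, Finset.card_univ] at this
          exact mul_le_mul_of_nonneg_left this (by linarith [hK0 a₀])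

/-- `n v'(S - Σ)w` as a bilinear form. -/
noncomputable def deviationForm {n p m : ℕ} (lam : Fin m → ℝ)
    (q : Fin m → EuclideanSpace ℝ (Fin p)) (x : Fin n → EuclideanSpace ℝ (Fin p)) :
    EuclideanSpace ℝ (Fin p) →ₗ[ℝ] EuclideanSpace ℝ (Fin p) →ₗ[ℝ] ℝ :=
  ∑ i, (innerₗ _ (x i)).smulRight (innerₗ _ (x i)) -
    (n : ℝ) • (∑ j, (lam j ^ 2) • (innerₗ _ (q j)).smulRight (innerₗ _ (q j)) + innerₗ _)

theorem deviationForm_apply {n p m : ℕ} (lam : Fin m → ℝ)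
    (q : Fin m → EuclideanSpace ℝ (Fin p)) (x : Fin n → EuclideanSpace ℝ (Fin p))
    (v w : EuclideanSpace ℝ (Fin p)) : deviationForm lam q x v w =
      ∑ i, inner ℝ (x i) v * inner ℝ (x i) w -
        n * (∑ j, lam j ^ 2 * (inner ℝ (q j) v * inner ℝ (q j) w) + inner ℝ v w) := by
  simp [deviationForm, LinearMap.sum_apply]
  ring

theorem deviationForm_self {n p m : ℕ} (lam : Fin m → ℝ)
    (q : Fin m → EuclideanSpace ℝ (Fin p)) (x : Fin n → EuclideanSpace ℝ (Fin p))
    (v : EuclideanSpace ℝ (Fin p)) : deviationForm lam q x v v = sampleForm x v -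
      n * (v ⬝ᵥ ((∑ j, lam j ^ 2 • Matrix.vecMulVec (q j) (q j)) + 1 :
        Matrix (Fin p) (Fin p) ℝ).mulVec v) := by
  rw [deviationForm_apply, dotProduct_spiked_mulVec, sampleForm, real_inner_self_eq_norm_sq]
  simp only [pow_two]

section Spikes

variable {p m k : ℕ} {lam : Fin m → ℝ} {q : Fin m → EuclideanSpace ℝ (Fin p)}

theorem spiked_form_le (hq : Orthonormal ℝ q) {μ : ℝ} (hμ : ∀ j, lam j ^ 2 ≤ μ) (hμ0 : 0 ≤ μ)
    (v : EuclideanSpace ℝ (Fin p)) :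
    v ⬝ᵥ ((∑ j, lam j ^ 2 • Matrix.vecMulVec (q j) (q j)) + 1 :
      Matrix (Fin p) (Fin p) ℝ).mulVec v ≤ (1 + μ) * ‖v‖ ^ 2 := by
  rw [dotProduct_spiked_mulVec]
  have h1 : ∑ j, (inner ℝ (q j) v) ^ 2 ≤ ‖v‖ ^ 2 := by
    have := hq.sum_inner_products_le v (s := Finset.univ)
    simpa using this
  have h2 : ∑ j, lam j ^ 2 * (inner ℝ (q j) v) ^ 2 ≤ μ * ∑ j, (inner ℝ (q j) v) ^ 2 := by
    rw [Finset.mul_sum]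
    exact Finset.sum_le_sum fun j _ => mul_le_mul_of_nonneg_right (hμ j) (sq_nonneg _)
  have h3 := mul_le_mul_of_nonneg_left h1 hμ0
  linarith

/-- Combinations of the first `k` spike directions, truncated to `A`. -/
noncomputable def truncatedSpan (q : Fin m → EuclideanSpace ℝ (Fin p)) (A : Finset (Fin p))
    (hk : k ≤ m) : (Fin k → ℝ) →ₗ[ℝ] EuclideanSpace ℝ (Fin p) :=
  Fintype.linearCombination ℝ fun a => coordProj A (q (Fin.castLE hk a))

theorem truncatedSpan_apply (A : Finset (Fin p)) (hk : k ≤ m) (c : Fin k → ℝ) :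
    truncatedSpan q A hk c = coordProj A (∑ a, c a • q (Fin.castLE hk a)) := by
  rw [truncatedSpan, Fintype.linearCombination_apply, map_sum]
  simp_rw [map_smul]

theorem norm_sum_smul_sq (hq : Orthonormal ℝ q) (hk : k ≤ m) (c : Fin k → ℝ) :
    ‖∑ a, c a • q (Fin.castLE hk a)‖ ^ 2 = ∑ a, c a ^ 2 := by
  have h := (hq.comp _ (Fin.castLE_injective hk)).inner_sum c c Finset.univ
  rw [← real_inner_self_eq_norm_sq]
  refine h.trans (Finset.sum_congr rfl fun a _ => ?_)
  rw [conj_trivial, pow_two]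

theorem norm_truncatedSpan_sq_ge (hq : Orthonormal ℝ q) (A : Finset (Fin p)) (hk : k ≤ m) {ρ : ℝ}
    (hρ : ∀ j, ‖q j - coordProj A (q j)‖ ^ 2 ≤ ρ) (hkρ : k * ρ ≤ 1 / 4) (c : Fin k → ℝ) :
    3 / 4 * ∑ a, c a ^ 2 ≤ ‖truncatedSpan q A hk c‖ ^ 2 := by
  rw [truncatedSpan_apply, norm_coordProj_sq, norm_sum_smul_sq hq hk]
  have h1 : ‖∑ a, c a • q (Fin.castLE hk a) -
      coordProj A (∑ a, c a • q (Fin.castLE hk a))‖ ^ 2 ≤ 1 / 4 * ∑ a, c a ^ 2 := by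
    have h2 : ∑ a, c a • q (Fin.castLE hk a) - coordProj A (∑ a, c a • q (Fin.castLE hk a)) =
        ∑ a, c a • (q (Fin.castLE hk a) - coordProj A (q (Fin.castLE hk a))) := by
      simp_rw [smul_sub, Finset.sum_sub_distrib, map_sum, map_smul]
    have h3 : ‖∑ a, c a • (q (Fin.castLE hk a) - coordProj A (q (Fin.castLE hk a)))‖ ≤
        ∑ a, |c a| * ‖q (Fin.castLE hk a) - coordProj A (q (Fin.castLE hk a))‖ := by
      refine (norm_sum_le _ _).trans (Finset.sum_le_sum fun a _ => ?_)
      rw [norm_smul, Real.norm_eq_abs]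
    have h4 : (∑ a, |c a| * ‖q (Fin.castLE hk a) - coordProj A (q (Fin.castLE hk a))‖) ^ 2 ≤
        (∑ a, |c a| ^ 2) *
          ∑ a, ‖q (Fin.castLE hk a) - coordProj A (q (Fin.castLE hk a))‖ ^ 2 :=
      Finset.sum_mul_sq_le_sq_mul_sq _ _ _
    have h5 : ∑ a, ‖q (Fin.castLE hk a) - coordProj A (q (Fin.castLE hk a))‖ ^ 2 ≤ k * ρ := by
      refine (Finset.sum_le_sum fun a _ => hρ _).trans ?_
      simp
    have hc0 : 0 ≤ ∑ a, c a ^ 2 := Finset.sum_nonneg fun _ _ => sq_nonneg _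
    rw [h2]
    calc _ ≤ (∑ a, |c a| * ‖q (Fin.castLE hk a) - coordProj A (q (Fin.castLE hk a))‖) ^ 2 :=
          pow_le_pow_left₀ (norm_nonneg _) h3 2
      _ ≤ _ := h4
      _ ≤ 1 / 4 * ∑ a, c a ^ 2 := by
        simp only [sq_abs]
        nlinarith
  linarith

/-- Truncation retains most of the spiked variance: the components of `w = R w₀` along the first
`k` spikes satisfy `‖w‖² = ⟨w₀, w⟩ ≤ ‖w₀‖ (∑ ⟨q_a, w⟩²)^{1/2}`. -/
theorem spiked_form_truncatedSpan_ge (hq : Orthonormal ℝ q) (A : Finset (Fin p)) (hk : k ≤ m)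
    {ρ l : ℝ} (hρ : ∀ j, ‖q j - coordProj A (q j)‖ ^ 2 ≤ ρ) (hkρ : k * ρ ≤ 1 / 4)
    (hl0 : 0 ≤ l) (hl : ∀ a, l ≤ lam (Fin.castLE hk a) ^ 2) (c : Fin k → ℝ) :
    (1 + 3 / 4 * l) * ‖truncatedSpan q A hk c‖ ^ 2 ≤
      truncatedSpan q A hk c ⬝ᵥ ((∑ j, lam j ^ 2 • Matrix.vecMulVec (q j) (q j)) + 1 :
        Matrix (Fin p) (Fin p) ℝ).mulVec (truncatedSpan q A hk c) := by
  have h1 := norm_truncatedSpan_sq_ge hq A hk hρ hkρ c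
  set w := truncatedSpan q A hk c with hw
  rw [dotProduct_spiked_mulVec]
  have h2 : ∑ a, lam (Fin.castLE hk a) ^ 2 * (inner ℝ (q (Fin.castLE hk a)) w) ^ 2 ≤
      ∑ j, lam j ^ 2 * (inner ℝ (q j) w) ^ 2 := by
    refine le_trans (le_of_eq (Finset.sum_map Finset.univ (Fin.castLEEmb hk)
      (fun j => lam j ^ 2 * (inner ℝ (q j) w) ^ 2)).symm) ?_
    exact Finset.sum_le_sum_of_subset_of_nonneg (Finset.subset_univ _) fun _ _ _ => by positivity
  have h3 : l * ∑ a, (inner ℝ (q (Fin.castLE hk a)) w) ^ 2 ≤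
      ∑ a, lam (Fin.castLE hk a) ^ 2 * (inner ℝ (q (Fin.castLE hk a)) w) ^ 2 := by
    rw [Finset.mul_sum]
    exact Finset.sum_le_sum fun a _ => mul_le_mul_of_nonneg_right (hl a) (sq_nonneg _)
  have h4 : ‖w‖ ^ 2 = ∑ a, c a * inner ℝ (q (Fin.castLE hk a)) w := by
    have := inner_coordProj_self A (∑ a, c a • q (Fin.castLE hk a))
    rw [← truncatedSpan_apply, ← hw, sum_inner] at this
    rw [← this]
    exact Finset.sum_congr rfl fun a _ => real_inner_smul_left _ _ _
  have h5 : (‖w‖ ^ 2) ^ 2 ≤ (∑ a, c a ^ 2) * ∑ a, (inner ℝ (q (Fin.castLE hk a)) w) ^ 2 := by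
    rw [h4]; exact Finset.sum_mul_sq_le_sq_mul_sq _ _ _
  set T := ∑ a, (inner ℝ (q (Fin.castLE hk a)) w) ^ 2 with hT
  have hT0 : 0 ≤ T := Finset.sum_nonneg fun _ _ => sq_nonneg _
  have h6 : 3 / 4 * ‖w‖ ^ 2 ≤ T := by
    rcases eq_or_lt_of_le (sq_nonneg ‖w‖) with h0 | hpos
    · rw [← h0]; simpa using hT0
    · have h7 : 3 / 4 * (‖w‖ ^ 2) ^ 2 ≤ ‖w‖ ^ 2 * T := by
        have := mul_le_mul_of_nonneg_right h1 hT0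
        linarith
      have h8 : ‖w‖ ^ 2 * (3 / 4 * ‖w‖ ^ 2) ≤ ‖w‖ ^ 2 * T := by linarith
      exact le_of_mul_le_mul_left h8 hpos
  have h7 := mul_le_mul_of_nonneg_left h6 hl0
  linarith

/-- The directions in which the sample variance is controlled: sums of two truncated spikes. -/
noncomputable def spikeSums (q : Fin m → EuclideanSpace ℝ (Fin p)) (A : Finset (Fin p)) :
    Fin m × Fin m → EuclideanSpace ℝ (Fin p) :=
  fun ab => coordProj A (q ab.1) + coordProj A (q ab.2)

/-- Lower bound for the sample variance on the truncated spikes. -/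
theorem sampleForm_truncatedSpan_ge {n : ℕ} (hq : Orthonormal ℝ q)
    (A : Finset (Fin p)) (hk : k ≤ m) {ρ l μ y : ℝ}
    (hρ : ∀ j, ‖q j - coordProj A (q j)‖ ^ 2 ≤ ρ) (hkρ : k * ρ ≤ 1 / 4)
    (hl0 : 0 ≤ l) (hl : ∀ a, l ≤ lam (Fin.castLE hk a) ^ 2)
    (hμ : ∀ j, lam j ^ 2 ≤ μ) (hμ0 : 0 ≤ μ) (hy0 : 0 ≤ y)
    (hyl : 16 * (y * (1 + μ) * k) ≤ l / 4) {x : Fin n → EuclideanSpace ℝ (Fin p)}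
    (hx : x ∉ varianceDeviates (4 * y) ((∑ j, lam j ^ 2 • Matrix.vecMulVec (q j) (q j)) + 1)
      (spikeSums q A)) (c : Fin k → ℝ) :
    n * (1 + l / 2) * ‖truncatedSpan q A hk c‖ ^ 2 ≤ sampleForm x (truncatedSpan q A hk c) := by
  have h1 := norm_truncatedSpan_sq_ge hq A hk hρ hkρ c
  have h2 := spiked_form_truncatedSpan_ge hq A hk hρ hkρ hl0 hl c
  have h3 := abs_bilin_sum_le (deviationForm lam q x)
    (fun u v => by
      rw [deviationForm_apply, deviationForm_apply, real_inner_comm]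
      simp_rw [mul_comm])
    (fun a : Fin k => coordProj A (q (Fin.castLE hk a))) (K := n * (4 * y * (1 + μ)))
    (fun a b => by
      have h4 : ¬ _ := fun h => hx ⟨(Fin.castLE hk a, Fin.castLE hk b), h⟩
      rw [not_lt] at h4
      rw [deviationForm_self]
      refine h4.trans ?_
      have h5 := spiked_form_le hq hμ hμ0 (spikeSums q A (Fin.castLE hk a, Fin.castLE hk b))
      have h6 : ‖spikeSums q A (Fin.castLE hk a, Fin.castLE hk b)‖ ≤ 2 := by
        refine (norm_add_le _ _).trans ?_
        have h7 := norm_coordProj_le A (q (Fin.castLE hk a))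
        have h8 := norm_coordProj_le A (q (Fin.castLE hk b))
        rw [hq.1] at h7 h8
        linarith
      have h9 := pow_le_pow_left₀ (norm_nonneg _) h6 2
      have h10 : (1 + μ) * ‖spikeSums q A (Fin.castLE hk a, Fin.castLE hk b)‖ ^ 2 ≤
          (1 + μ) * 2 ^ 2 := mul_le_mul_of_nonneg_left h9 (by linarith)
      have h11 := mul_le_mul_of_nonneg_left (h5.trans h10) (show 0 ≤ 4 * y by linarith)
      have h12 := mul_le_mul_of_nonneg_left h11 (Nat.cast_nonneg (α := ℝ) n)
      refine h12.trans (le_of_eq ?_)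
      ring) c
  have h13 : ∑ a, c a • coordProj A (q (Fin.castLE hk a)) = truncatedSpan q A hk c := by
    rw [truncatedSpan, Fintype.linearCombination_apply]
  rw [h13, deviationForm_self, Fintype.card_fin] at h3
  have h14 := (abs_le.1 h3).1
  have hn0 := Nat.cast_nonneg (α := ℝ) n
  have h15 := mul_le_mul_of_nonneg_left h2 hn0
  set N := ‖truncatedSpan q A hk c‖ ^ 2
  set C := ∑ a, c a ^ 2
  have hN0 : 0 ≤ N := sq_nonneg _
  have h16 : 3 * (n * (4 * y * (1 + μ))) * (k * C) ≤ n * (l / 4 * N) := by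
    have h17 : 0 ≤ y * (1 + μ) * k := by positivity
    calc 3 * (n * (4 * y * (1 + μ))) * (k * C) = n * (12 * (y * (1 + μ) * k) * C) := by ring
      _ ≤ n * (l / 4 * N) := by
        refine mul_le_mul_of_nonneg_left ?_ hn0
        have h18 := mul_le_mul_of_nonneg_left h1 h17
        have h19 := mul_le_mul_of_nonneg_right hyl hN0
        linarith
  linarith

theorem truncatedSpan_injective (hq : Orthonormal ℝ q) (A : Finset (Fin p)) (hk : k ≤ m) {ρ : ℝ}
    (hρ : ∀ j, ‖q j - coordProj A (q j)‖ ^ 2 ≤ ρ) (hkρ : k * ρ ≤ 1 / 4) :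
    Function.Injective (truncatedSpan q A hk) := by
  rw [← LinearMap.ker_eq_bot, LinearMap.ker_eq_bot']
  intro c hc
  have h1 := norm_truncatedSpan_sq_ge hq A hk hρ hkρ c
  rw [hc, norm_zero] at h1
  have h2 : ∑ a, c a ^ 2 = 0 :=
    le_antisymm (by linarith) (Finset.sum_nonneg fun _ _ => sq_nonneg _)
  rw [Finset.sum_eq_zero_iff_of_nonneg fun _ _ => sq_nonneg _] at h2
  ext a
  exact pow_eq_zero_iff (two_ne_zero) |>.1 (h2 a (Finset.mem_univ a))

theorem spiked_diag (lam : Fin m → ℝ) (q : Fin m → EuclideanSpace ℝ (Fin p)) (ν : Fin p) :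
    ((∑ j, lam j ^ 2 • Matrix.vecMulVec (q j) (q j)) + 1 : Matrix (Fin p) (Fin p) ℝ) ν ν =
      1 + ∑ j, lam j ^ 2 * q j ν ^ 2 := by
  rw [Matrix.add_apply, Matrix.sum_apply, Matrix.one_apply_eq, add_comm]
  congr 1
  refine Finset.sum_congr rfl fun j _ => ?_
  rw [Matrix.smul_apply, Matrix.vecMulVec_apply, smul_eq_mul, pow_two (q j ν)]

end Spikes

/-! ### Detection of spikes at a fixed sample size -/

/-- The coordinates at which the variance is at least `1 + b`. -/
noncomputable def largeVariance {p : ℕ} (Sig : Matrix (Fin p) (Fin p) ℝ) (b : ℝ) :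
    Finset (Fin p) :=
  {ν | 1 + b ≤ Sig ν ν}

section FixedSampleSize

variable {p m : ℕ} {lam s : Fin m → ℝ} {q : Fin m → EuclideanSpace ℝ (Fin p)} {r : ℝ}

theorem sqrt_rpow_eq {a : ℝ} (ha : 0 ≤ a) (b : ℝ) : √a ^ b = a ^ (b / 2) := by
  rw [Real.sqrt_eq_rpow, ← Real.rpow_mul ha]
  congr 1; ring

/-- Truncating a sparse spike to the coordinates of large variance loses little of its norm: a
coordinate of variance below `1 + b y` has `λ_j² q_{jν}² < b y`. -/
theorem norm_sub_coordProj_largeVariance_sq_le (hr : 0 < r) (hr2 : r < 2)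
    (hlam : ∀ j, 0 < lam j) (hs : ∀ j, 0 < s j) (hq : ∀ j, WeakBall r (s j) (q j))
    {b y : ℝ} (hb : 0 ≤ b) (hy : 0 ≤ y) (j : Fin m) :
    ‖q j - coordProj (largeVariance ((∑ j, lam j ^ 2 • Matrix.vecMulVec (q j) (q j)) + 1)
      (b * y)) (q j)‖ ^ 2 ≤
      2 / (2 - r) * b ^ (1 - r / 2) * (s j ^ r * (y / lam j ^ 2) ^ (1 - r / 2)) := by
  have hl : 0 < lam j ^ 2 := pow_pos (hlam j) 2
  have hby : 0 ≤ b * (y / lam j ^ 2) := by positivity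
  rw [norm_sub_coordProj_sq]
  set τ := √(b * (y / lam j ^ 2)) with hτ
  have h1 : ∀ ν ∈ (largeVariance ((∑ j, lam j ^ 2 • Matrix.vecMulVec (q j) (q j)) + 1)
      (b * y))ᶜ, q j ν ^ 2 ≤ min |q j ν| τ ^ 2 := by
    intro ν hν
    have h2 : ¬ (1 + b * y ≤ ((∑ j, lam j ^ 2 • Matrix.vecMulVec (q j) (q j)) + 1 :
        Matrix (Fin p) (Fin p) ℝ) ν ν) := by
      simpa only [largeVariance, Finset.mem_compl, Finset.mem_filter, Finset.mem_univ,
        true_and] using hν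
    rw [spiked_diag, not_le] at h2
    have h3 : lam j ^ 2 * q j ν ^ 2 ≤ ∑ i, lam i ^ 2 * q i ν ^ 2 :=
      Finset.single_le_sum (f := fun i => lam i ^ 2 * q i ν ^ 2) (fun i _ => by positivity)
        (Finset.mem_univ j)
    have h4 : |q j ν| ≤ τ := by
      apply Real.le_sqrt_of_sq_le
      rw [sq_abs, ← mul_div_assoc, le_div_iff₀ hl]
      linarith
    rw [min_eq_left h4, sq_abs]
  calc ∑ ν ∈ (largeVariance ((∑ j, lam j ^ 2 • Matrix.vecMulVec (q j) (q j)) + 1) (b * y))ᶜ,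
        q j ν ^ 2 ≤ ∑ ν, min |q j ν| τ ^ 2 :=
        (Finset.sum_le_sum h1).trans (Finset.sum_le_sum_of_subset_of_nonneg
          (Finset.subset_univ _) fun _ _ _ => sq_nonneg _)
    _ ≤ 2 / (2 - r) * (s j ^ r * τ ^ (2 - r)) :=
        (hq j).sum_min_sq_le hr hr2 (hs j) (Real.sqrt_nonneg _)
    _ = _ := by
        rw [hτ, sqrt_rpow_eq hby, show (2 - r) / 2 = 1 - r / 2 by ring,
          Real.mul_rpow hb (by positivity)]
        ring

/-- Few coordinates of sparse spikes have large variance: if the variance at `ν` is at least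
`1 + m b y`, then `λ_j² q_{jν}² ≥ b y` for some `j`. -/
theorem card_largeVariance_mul_sq_le (hr : 0 < r) (hm : 1 ≤ m)
    (hlam : ∀ j, 0 < lam j) (hs : ∀ j, 0 < s j) (hq : ∀ j, WeakBall r (s j) (q j))
    {b y c μ : ℝ} (hb : 0 < b) (hy : 0 < y) (hμ : ∀ j, lam j ^ 2 ≤ μ) (hc : 0 ≤ c)
    (hG : ∀ j, s j ^ r * (y / lam j ^ 2) ^ (1 - r / 2) ≤ c) :
    ((largeVariance ((∑ j, lam j ^ 2 • Matrix.vecMulVec (q j) (q j)) + 1) (m * b * y)).card : ℝ) *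
      y ^ 2 ≤ m * b ^ (-(r / 2)) * (c * (μ * y)) := by
  have hm0 : (0 : ℝ) < m := by exact_mod_cast hm
  set τ : Fin m → ℝ := fun j => √(b * (y / lam j ^ 2)) with hτ
  have hsub : largeVariance ((∑ j, lam j ^ 2 • Matrix.vecMulVec (q j) (q j)) + 1) (m * b * y) ⊆
      Finset.univ.biUnion fun j : Fin m => Finset.univ.filter fun ν => τ j ≤ |q j ν| := by
    intro ν hν
    have h2 : 1 + m * b * y ≤ ((∑ j, lam j ^ 2 • Matrix.vecMulVec (q j) (q j)) + 1 :
        Matrix (Fin p) (Fin p) ℝ) ν ν := by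
      simpa only [largeVariance, Finset.mem_filter, Finset.mem_univ, true_and] using hν
    rw [spiked_diag] at h2
    by_contra hcon
    simp only [Finset.mem_biUnion, Finset.mem_univ, Finset.mem_filter, true_and, not_exists,
      not_le] at hcon
    have h3 : ∀ j ∈ Finset.univ, lam j ^ 2 * q j ν ^ 2 < b * y := by
      intro j _
      have hl : 0 < lam j ^ 2 := pow_pos (hlam j) 2
      have h4 := (Real.lt_sqrt (abs_nonneg _)).1 (hcon j)
      rw [sq_abs, ← mul_div_assoc, lt_div_iff₀ hl] at h4
      linarith
    have h5 := Finset.sum_lt_sum_of_nonempty ⟨⟨0, hm⟩, Finset.mem_univ _⟩ h3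
    rw [Finset.sum_const, Finset.card_univ, Fintype.card_fin, nsmul_eq_mul] at h5
    linarith
  have hcard : ((largeVariance ((∑ j, lam j ^ 2 • Matrix.vecMulVec (q j) (q j)) + 1)
      (m * b * y)).card : ℝ) ≤ ∑ j, s j ^ r * τ j ^ (-r) := by
    refine (Nat.cast_le.2 ((Finset.card_le_card hsub).trans Finset.card_biUnion_le)).trans ?_
    push_cast
    refine Finset.sum_le_sum fun j _ => (hq j).card_le hr (hs j) ?_
    have hl : 0 < lam j ^ 2 := pow_pos (hlam j) 2
    exact Real.sqrt_pos.2 (by positivity)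
  have hterm : ∀ j ∈ Finset.univ, s j ^ r * τ j ^ (-r) * y ^ 2 ≤
      b ^ (-(r / 2)) * (c * (μ * y)) := by
    intro j _
    have hl : 0 < lam j ^ 2 := pow_pos (hlam j) 2
    have hyl : 0 < y / lam j ^ 2 := by positivity
    have h6 : τ j ^ (-r) = b ^ (-(r / 2)) * (y / lam j ^ 2) ^ (-(r / 2)) := by
      rw [hτ, sqrt_rpow_eq (by positivity), neg_div, Real.mul_rpow hb.le hyl.le]
    have h7 : (y / lam j ^ 2) ^ (1 - r / 2) =
        (y / lam j ^ 2) * (y / lam j ^ 2) ^ (-(r / 2)) := by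
      rw [sub_eq_add_neg, Real.rpow_add hyl, Real.rpow_one]
    have h8 : s j ^ r * τ j ^ (-r) * y ^ 2 = b ^ (-(r / 2)) *
        (s j ^ r * (y / lam j ^ 2) ^ (1 - r / 2) * (lam j ^ 2 * y)) := by
      have hlj := (hlam j).ne'
      rw [h6, h7]
      field_simp
    rw [h8]
    refine mul_le_mul_of_nonneg_left ?_ (by positivity)
    exact mul_le_mul (hG j) (mul_le_mul_of_nonneg_right (hμ j) hy.le) (by positivity) hc
  calc _ ≤ (∑ j, s j ^ r * τ j ^ (-r)) * y ^ 2 := mul_le_mul_of_nonneg_right hcard (sq_nonneg y)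
    _ = ∑ j, s j ^ r * τ j ^ (-r) * y ^ 2 := Finset.sum_mul _ _ _
    _ ≤ _ := Finset.sum_le_sum hterm
    _ = _ := by
      rw [Finset.sum_const, Finset.card_univ, Fintype.card_fin, nsmul_eq_mul]; ring

/-- The threshold is small compared to the leading spike if the number of selected coordinates is
small. -/
theorem deltaK_le {p n k : ℕ} (hn : 1 ≤ n) {y η μ : ℝ} (hL : 1 ≤ Real.log (pn p n))
    (hy : y ^ 2 = Real.log (pn p n) / n) (hη : 0 ≤ η) (hμ : 0 ≤ μ)
    (h1 : 10 * (k * y ^ 2) + 12 * y ^ 2 ≤ η ^ 2 * μ)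
    (h2 : 10 * (k * y ^ 2) + 12 * y ^ 2 ≤ η ^ 2 * μ ^ 2) :
    deltaK p n k ≤ (2 * η + η ^ 2) * μ := by
  have hn0 : (0 : ℝ) < n := by exact_mod_cast hn
  have hk0 : (0 : ℝ) ≤ k := Nat.cast_nonneg k
  set L := Real.log (pn p n) with hLdef
  set w := √((k : ℝ) / n) + tK p n k with hw
  have hw0 : 0 ≤ w := add_nonneg (Real.sqrt_nonneg _) (Real.sqrt_nonneg _)
  have hk1 : √((k : ℝ) / n) ^ 2 = k / n := Real.sq_sqrt (by positivity)
  have hk2 : tK p n k ^ 2 = 6 * L / n + 2 * k * (L + 1) / n := Real.sq_sqrt (by positivity)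
  have hkn : (k : ℝ) / n ≤ k * y ^ 2 := by
    rw [hy, ← mul_div_assoc]
    exact div_le_div_of_nonneg_right (le_mul_of_one_le_right hk0 hL) hn0.le
  have hw2 : w ^ 2 ≤ 10 * (k * y ^ 2) + 12 * y ^ 2 := by
    have h3 : w ^ 2 ≤ 2 * (√((k : ℝ) / n) ^ 2 + tK p n k ^ 2) := by
      rw [hw]; nlinarith [sq_nonneg (√((k : ℝ) / n) - tK p n k)]
    have h4 : 6 * L / n + 2 * k * (L + 1) / n = 6 * y ^ 2 + 2 * (k * y ^ 2) + 2 * (k / n) := by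
      rw [hy]; field_simp; ring
    rw [hk1, hk2, h4] at h3
    linarith
  have hw3 : w ≤ η * μ := by
    have : w ^ 2 ≤ (η * μ) ^ 2 := by rw [mul_pow]; linarith
    exact (sq_le_sq₀ hw0 (by positivity)).1 this
  have : deltaK p n k = 2 * w + w ^ 2 := rfl
  rw [this]
  nlinarith

/-- Outside the exceptional events, `k + 1 ≤ m̂` if the first `k + 1` spikes are comparable to
`λ_1²` and the relevant rates are below a small constant `c`. -/
theorem le_hatM_of_not_mem {n k : ℕ} (hn : 1 ≤ n) (hm : 1 ≤ m) (hr : 0 < r) (hr2 : r < 2)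
    (hlam : ∀ j, 0 < lam j) (hs : ∀ j, 0 < s j) (hqo : Orthonormal ℝ q)
    (hq : ∀ j, WeakBall r (s j) (q j)) (hk : k + 1 ≤ m) {α b y c μ κ l : ℝ}
    (hα : 0 < α) (hb : 0 < b) (hy0 : 0 < y) (hL : 1 ≤ Real.log (pn p n))
    (hy : y = √(Real.log (pn p n) / n)) (hκ : 1 ≤ κ) (hc0 : 0 < c)
    (hμ : ∀ j, lam j ^ 2 ≤ μ) (hl : ∀ a, l ≤ lam (Fin.castLE hk a) ^ 2) (hlμ : μ / κ ≤ l)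
    (hyc : y ≤ c * min 1 μ) (hG : ∀ j, s j ^ r * (y / lam j ^ 2) ^ (1 - r / 2) ≤ c)
    (hc1 : 2 / (2 - r) * (3 * α) ^ (1 - r / 2) * c * m ≤ 1 / 4) (hc2 : 128 * m * κ * c ≤ 1)
    (hc3 : (10 * (m * b ^ (-(r / 2))) + 12) * c ^ 2 ≤ (1 / (8 * κ)) ^ 2)
    {x : Fin n → EuclideanSpace ℝ (Fin p)}
    (hx1 : x ∉ selectionFails α (m * b * y) (3 * alphaN α p n)
      ((∑ j, lam j ^ 2 • Matrix.vecMulVec (q j) (q j)) + 1))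
    (hx2 : x ∉ varianceDeviates (4 * y) ((∑ j, lam j ^ 2 • Matrix.vecMulVec (q j) (q j)) + 1)
      (spikeSums q (largeVariance ((∑ j, lam j ^ 2 • Matrix.vecMulVec (q j) (q j)) + 1)
        (3 * α * y)))) :
    k + 1 ≤ hatM α x := by
  set Sig : Matrix (Fin p) (Fin p) ℝ := (∑ j, lam j ^ 2 • Matrix.vecMulVec (q j) (q j)) + 1
    with hSig
  have hm0 : (1 : ℝ) ≤ m := by exact_mod_cast hm
  have hkm : ((k + 1 : ℕ) : ℝ) ≤ m := by exact_mod_cast hk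
  have hμ0 : 0 < μ := lt_of_lt_of_le (pow_pos (hlam ⟨0, hm⟩) 2) (hμ ⟨0, hm⟩)
  have hl0 : 0 < l := lt_of_lt_of_le (by positivity) hlμ
  have hαN : alphaN α p n = α * y := by rw [alphaN, hy]
  have hn0 : (0 : ℝ) < n := by exact_mod_cast hn
  have hy2 : y ^ 2 = Real.log (pn p n) / n := by rw [hy]; exact Real.sq_sqrt (by positivity)
  have hz1 : min 1 μ ≤ 1 := min_le_left _ _
  have hz2 : min 1 μ ≤ μ := min_le_right _ _
  have hz0 : 0 < min 1 μ := lt_min one_pos hμ0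
  rw [hαN] at hx1
  set A := largeVariance Sig (3 * α * y) with hA
  have hρ : ∀ j, ‖q j - coordProj A (q j)‖ ^ 2 ≤
      2 / (2 - r) * (3 * α) ^ (1 - r / 2) * c := by
    intro j
    refine (norm_sub_coordProj_largeVariance_sq_le hr hr2 hlam hs hq (by positivity) hy0.le
      j).trans (mul_le_mul_of_nonneg_left (hG j) ?_)
    have : 0 < 2 - r := by linarith
    positivity
  have hρ0 : 0 ≤ 2 / (2 - r) * (3 * α) ^ (1 - r / 2) * c := by
    have : 0 < 2 - r := by linarith
    positivity
  have hkρ : ((k + 1 : ℕ) : ℝ) * (2 / (2 - r) * (3 * α) ^ (1 - r / 2) * c) ≤ 1 / 4 := by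
    have := mul_le_mul_of_nonneg_right hkm hρ0
    linarith
  -- the retained coordinates are selected
  have hAsub : A ⊆ selected α x := by
    intro ν hν
    by_contra hcon
    refine hx1 ⟨ν, Or.inr ⟨?_, hcon⟩⟩
    rw [← mul_assoc]
    simpa only [hA, largeVariance, Finset.mem_filter, Finset.mem_univ, true_and] using hν
  -- the selected coordinates have large variance, hence are few
  have hBsub : selected α x ⊆ largeVariance Sig (m * b * y) := by
    intro ν hν
    simp only [largeVariance, Finset.mem_filter, Finset.mem_univ, true_and]
    by_contra hcon
    exact hx1 ⟨ν, Or.inl ⟨not_le.1 hcon, hν⟩⟩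
  set C₂ := m * b ^ (-(r / 2)) with hC₂
  have hC₂0 : 0 ≤ C₂ := by positivity
  have hcard : ((selected α x).card : ℝ) * y ^ 2 ≤ C₂ * (c * (μ * y)) := by
    refine le_trans (mul_le_mul_of_nonneg_right ?_ (sq_nonneg y))
      (card_largeVariance_mul_sq_le hr hm hlam hs hq hb hy0 hμ hc0.le hG)
    exact_mod_cast Finset.card_le_card hBsub
  have hall : 10 * (((selected α x).card : ℝ) * y ^ 2) + 12 * y ^ 2 ≤
      (1 / (8 * κ)) ^ 2 * (μ * min 1 μ) := by
    have h1 : C₂ * (c * (μ * y)) ≤ C₂ * (c * (μ * (c * min 1 μ))) := by gcongr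
    have h2 : y ^ 2 ≤ c ^ 2 * (μ * min 1 μ) := by
      calc y ^ 2 ≤ (c * min 1 μ) ^ 2 := pow_le_pow_left₀ hy0.le hyc 2
        _ = c ^ 2 * (min 1 μ * min 1 μ) := by ring
        _ ≤ c ^ 2 * (μ * min 1 μ) := by gcongr
    have h3 := mul_le_mul_of_nonneg_right hc3 (show 0 ≤ μ * min 1 μ by positivity)
    linarith
  have hδ : deltaK p n (selected α x).card < l / 2 := by
    have h1 := deltaK_le (p := p) (k := (selected α x).card) hn hL hy2
      (show 0 ≤ 1 / (8 * κ) by positivity) hμ0.le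
      (hall.trans (mul_le_mul_of_nonneg_left (mul_le_of_le_one_right hμ0.le hz1)
        (by positivity)))
      (hall.trans (mul_le_mul_of_nonneg_left
        ((mul_le_mul_of_nonneg_left hz2 hμ0.le).trans (le_of_eq (pow_two μ).symm))
        (by positivity)))
    refine h1.trans_lt ?_
    have h2 : 2 * (1 / (8 * κ)) + (1 / (8 * κ)) ^ 2 < 1 / κ / 2 := by
      have h3 : 1 / (8 * κ) = 1 / κ / 8 := by field_simp
      have h4 : 1 / κ ≤ 1 := by rw [div_le_one (by linarith)]; exact hκ
      have h5 : 0 < 1 / κ := by positivity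
      rw [h3]
      nlinarith
    have h6 := mul_lt_mul_of_pos_right h2 hμ0
    have h7 : 1 / κ / 2 * μ = μ / κ / 2 := by ring
    linarith
  refine lt_hatM_of_form_ge hn (truncatedSpan q A hk)
    (truncatedSpan_injective hqo A hk hρ hkρ) ?_ (t := 1 + l / 2) (by linarith) ?_
  · intro c ν hν
    rw [truncatedSpan_apply, coordProj_apply, if_neg fun h => hν (hAsub h)]
  · refine sampleForm_truncatedSpan_ge hqo A hk hρ hkρ hl0.le hl hμ hμ0.le hy0.le ?_ hx2
    have h1 : y * (1 + μ) ≤ 2 * c * μ := by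
      have h2 : y ≤ c * μ := hyc.trans (mul_le_mul_of_nonneg_left hz2 hc0.le)
      have h3 : y ≤ c := hyc.trans (mul_le_of_le_one_right hc0.le hz1)
      have h5 := mul_le_mul_of_nonneg_right h3 hμ0.le
      linarith
    have h4 : μ ≤ κ * l := by
      rw [div_le_iff₀ (by linarith)] at hlμ; linarith
    have h5 : y * (1 + μ) * ((k + 1 : ℕ) : ℝ) ≤ 2 * c * (κ * l) * m := by
      have h6 : 2 * c * μ ≤ 2 * c * (κ * l) := mul_le_mul_of_nonneg_left h4 (by positivity)
      exact mul_le_mul (h1.trans h6) hkm (Nat.cast_nonneg _) (by positivity)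
    have h7 := mul_le_mul_of_nonneg_right hc2 hl0.le
    linarith

end FixedSampleSize

/-! ### Growth rates and consistency -/

/-- The complementary form of `IsSample.measure_le`. -/
theorem IsSample.le_measureReal {Ω : Type*} [MeasurableSpace Ω] {P : Measure Ω}
    [IsProbabilityMeasure P] {n p : ℕ} {Sig : Matrix (Fin p) (Fin p) ℝ}
    {X : Fin n → Ω → EuclideanSpace ℝ (Fin p)} (h : IsSample P Sig X)
    {bad : Set (Fin n → EuclideanSpace ℝ (Fin p))} {ε : ℝ} (hε : 0 ≤ ε)
    (hbad : sampleLaw n Sig bad ≤ ENNReal.ofReal ε)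
    {good : (Fin n → EuclideanSpace ℝ (Fin p)) → Prop} (hgood : ∀ x, x ∉ bad → good x) :
    1 - ε ≤ P.real {ω | good fun i => X i ω} := by
  have h1 : P.real {ω | (fun i => X i ω) ∈ bad} ≤ ε := by
    rw [measureReal_def]
    exact ENNReal.toReal_le_of_le_ofReal hε ((h.measure_le bad).trans hbad)
  have h2 : (Set.univ : Set Ω) ⊆ {ω | good fun i => X i ω} ∪ {ω | (fun i => X i ω) ∈ bad} := by
    intro ω _
    by_cases hω : (fun i => X i ω) ∈ bad
    · exact Or.inr hω
    · exact Or.inl (hgood _ hω)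
  have h3 := (measureReal_mono h2 (μ := P)).trans (measureReal_union_le _ _)
  rw [probReal_univ] at h3
  linarith

theorem le_pn_right (p n : ℕ) : (n : ℝ) ≤ pn p n := by
  unfold pn; exact_mod_cast le_max_right _ _

theorem one_le_exp_mul_inv_pn_sq {p n : ℕ} (hn : 1 ≤ n) (h : Real.log (pn p n) < 100) {C : ℝ}
    (hC : Real.exp 200 ≤ C) : 1 ≤ C * (pn p n ^ 2)⁻¹ := by
  have hP : 0 < pn p n := lt_of_lt_of_le one_pos (one_le_pn hn)
  rw [← div_eq_mul_inv, one_le_div (by positivity)]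
  refine le_trans ?_ hC
  rw [← Real.log_le_iff_le_exp (by positivity), Real.log_pow]
  push_cast
  linarith

section Asymptotics

variable {mbar : ℕ} {r : ℝ} {p : ℕ → ℕ} {lam s : ℕ → Fin mbar → ℝ}

theorem spikeSq_eq {j : ℕ} (n : ℕ) (h : 1 ≤ j ∧ j ≤ mbar) :
    spikeSq lam n j = lam n ⟨j - 1, by omega⟩ ^ 2 := by
  rw [spikeSq, dif_pos h]

theorem spikeSq_nonneg (n j : ℕ) : 0 ≤ spikeSq lam n j := by
  unfold spikeSq
  split_ifs <;> positivity

theorem sq_le_spikeSq_one (hm : 1 ≤ mbar) (hlam : ∀ n j, 0 < lam n j)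
    (hanti : ∀ n, Antitone (lam n)) (n : ℕ) (j : Fin mbar) : lam n j ^ 2 ≤ spikeSq lam n 1 := by
  rw [spikeSq_eq n ⟨le_rfl, hm⟩]
  exact pow_le_pow_left₀ (hlam n j).le (hanti n (Fin.mk_le_of_le_val (Nat.zero_le _))) 2

theorem GR.tendsto_sqrt (h : GR r p lam) :
    Tendsto (fun n : ℕ => √(Real.log (pn (p n) n) / n)) atTop (𝓝 0) := by
  have h1 : Tendsto (fun n : ℕ => Real.log (p n) / n) atTop (𝓝 0) :=
    (isLittleO_one_iff ℝ).1 h.dim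
  have h2 : Tendsto (fun n : ℕ => Real.log n / n) atTop (𝓝 0) :=
    (Real.isLittleO_log_id_atTop.tendsto_div_nhds_zero).comp tendsto_natCast_atTop_atTop
  have h3 : Tendsto (fun n : ℕ => Real.log (pn (p n) n) / n) atTop (𝓝 0) := by
    refine squeeze_zero (fun n => ?_) (fun n => ?_) (by simpa using h1.add h2)
    · exact div_nonneg (Real.log_natCast_nonneg _) (Nat.cast_nonneg _)
    · rw [← add_div]
      refine div_le_div_of_nonneg_right ?_ (Nat.cast_nonneg _)
      have h4 := Real.log_natCast_nonneg (p n)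
      have h5 := Real.log_natCast_nonneg n
      rcases max_cases (p n) n with ⟨h6, _⟩ | ⟨h6, _⟩ <;> rw [pn, h6] <;> linarith
  simpa using h3.sqrt

theorem eventually_le_log_pn (p : ℕ → ℕ) (c : ℝ) :
    ∀ᶠ n : ℕ in atTop, c ≤ Real.log (pn (p n) n) := by
  have h := (Real.tendsto_log_atTop.comp tendsto_natCast_atTop_atTop).eventually_ge_atTop c
  filter_upwards [h, eventually_ge_atTop 1] with n hn hn1
  have : (0 : ℝ) < n := by exact_mod_cast hn1
  exact hn.trans (Real.log_le_log this (le_pn_right _ _))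

/-- `√(log p_n / n)` is negligible compared to `1 ∧ λ_1²`. -/
theorem GR.eventually_sqrt_le (h : GR r p lam) (hm : 1 ≤ mbar) (hlam : ∀ n j, 0 < lam n j)
    (hanti : ∀ n, Antitone (lam n)) {c : ℝ} (hc : 0 < c) :
    ∀ᶠ n : ℕ in atTop, √(Real.log (pn (p n) n) / n) ≤ c * min 1 (spikeSq lam n 1) := by
  have h1 := h.tendsto_sqrt.eventually_le_const hc
  have h2 := h.smallest.bound (pow_pos hc 2)
  filter_upwards [h1, h2, eventually_ge_atTop 1] with n hn1 hn2 hn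
  have hn0 : (0 : ℝ) < n := by exact_mod_cast hn
  rw [mul_min_of_nonneg _ _ hc.le, mul_one]
  refine le_min hn1 ?_
  have h3 : spikeSq lam n mbar ≤ spikeSq lam n 1 := by
    rw [spikeSq_eq n ⟨hm, le_rfl⟩]
    exact sq_le_spikeSq_one hm hlam hanti n _
  have h4 := spikeSq_nonneg (lam := lam) n mbar
  refine le_trans ?_ (mul_le_mul_of_nonneg_left h3 hc.le)
  refine Real.sqrt_le_iff.2 ⟨by positivity, ?_⟩
  rw [Real.norm_of_nonneg (Real.log_nonneg (one_le_pn hn)),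
    Real.norm_of_nonneg (by positivity)] at hn2
  rw [div_le_iff₀ hn0]
  linarith

/-- The sparsity condition, as a bound on the rates that govern truncation and selection. -/
theorem SP.eventually_le (h : SP r p lam s) (hlam : ∀ n j, 0 < lam n j) {c : ℝ} (hc : 0 < c)
    (j : Fin mbar) : ∀ᶠ n : ℕ in atTop,
      s n j ^ r * (√(Real.log (pn (p n) n) / n) / lam n j ^ 2) ^ (1 - r / 2) ≤ c := by
  filter_upwards [(h.sparse j).bound hc, eventually_ge_atTop 1] with n hn hn1
  have hn0 : (0 : ℝ) < n := by exact_mod_cast hn1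
  have hl := hlam n j
  have hL : 0 ≤ Real.log (pn (p n) n) := Real.log_nonneg (one_le_pn hn1)
  have h1 : Real.log (pn (p n) n) / (n * lam n j ^ 4) =
      (√(Real.log (pn (p n) n) / n) / lam n j ^ 2) ^ (2 : ℝ) := by
    rw [Real.rpow_two, div_pow, Real.sq_sqrt (by positivity)]
    field_simp
  rw [h1, ← Real.rpow_mul (by positivity), show 2 * (1 / 2 - r / 4) = 1 - r / 2 by ring] at hn
  refine (Real.le_norm_self _).trans (hn.trans ?_)
  rw [Real.norm_of_nonneg (le_min zero_le_one (sq_nonneg _))]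
  exact mul_le_of_le_one_right hc.le (min_le_left _ _)

end Asymptotics

theorem exists_small_constant {A B D e : ℝ} (he : 0 < e) :
    ∃ c : ℝ, 0 < c ∧ A * c ≤ 1 / 4 ∧ B * c ≤ 1 ∧ D * c ^ 2 ≤ e ^ 2 := by
  have h1 : Tendsto (fun c : ℝ => A * c) (𝓝[>] 0) (𝓝 0) := by
    have : Continuous fun c : ℝ => A * c := by fun_prop
    simpa using (this.tendsto 0).mono_left nhdsWithin_le_nhds
  have h2 : Tendsto (fun c : ℝ => B * c) (𝓝[>] 0) (𝓝 0) := by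
    have : Continuous fun c : ℝ => B * c := by fun_prop
    simpa using (this.tendsto 0).mono_left nhdsWithin_le_nhds
  have h3 : Tendsto (fun c : ℝ => D * c ^ 2) (𝓝[>] 0) (𝓝 0) := by
    have : Continuous fun c : ℝ => D * c ^ 2 := by fun_prop
    simpa using (this.tendsto 0).mono_left nhdsWithin_le_nhds
  obtain ⟨c, hc, hc1, hc2, hc3⟩ := (eventually_mem_nhdsWithin.and
    ((h1.eventually_le_const (by norm_num : (0 : ℝ) < 1 / 4)).and
      ((h2.eventually_le_const one_pos).and
        (h3.eventually_le_const (by positivity : 0 < e ^ 2))))).exists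
  exact ⟨c, hc, hc1, hc2, hc3⟩

/-- Selection and the sample variances along the truncated spikes are reliable once
`y = √(log p_n / n)` is small. The variance level `d y` below which no coordinate is selected, and
the relative deviation `(2√3 + d) y`, come from `α = 2√3 + 3 d`: the chi-square tail at
`(2√3 + d) y` is below `p_n⁻³`. -/
theorem sampleLaw_selection_deviation_le {p m n : ℕ} (hn : 1 ≤ n) (lam : Fin m → ℝ)
    (q : Fin m → EuclideanSpace ℝ (Fin p)) {α d y : ℝ} (hd : 0 < d) (hα : α = 2 * √3 + 3 * d)
    (hy : y = √(Real.log (pn p n) / n)) (hcard : 2 * ((m : ℝ) * m) ≤ pn p n)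
    (hy1 : y ≤ 1 / 64) (hy2 : (2 * √3 + d) * y ≤ 1 / 2)
    (hy3 : (2 * √3 + d) ^ 3 * y ≤ (2 * √3 + d) ^ 2 / 4 - 3) (hy4 : α * y ≤ 1 / 3) :
    sampleLaw n ((∑ j, lam j ^ 2 • Matrix.vecMulVec (q j) (q j)) + 1)
      (selectionFails α (d * y) (3 * alphaN α p n)
        ((∑ j, lam j ^ 2 • Matrix.vecMulVec (q j) (q j)) + 1) ∪
       varianceDeviates (4 * y) ((∑ j, lam j ^ 2 • Matrix.vecMulVec (q j) (q j)) + 1)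
        (spikeSums q (largeVariance ((∑ j, lam j ^ 2 • Matrix.vecMulVec (q j) (q j)) + 1)
          (3 * α * y)))) ≤ ENNReal.ofReal (3 * (pn p n ^ 2)⁻¹) := by
  have hS := posSemidef_spiked lam q
  have hP : 0 < pn p n := lt_of_lt_of_le one_pos (one_le_pn hn)
  have hn0 : (0 : ℝ) < n := by exact_mod_cast hn
  have hL : 0 ≤ Real.log (pn p n) := Real.log_nonneg (one_le_pn hn)
  have hy0 : 0 ≤ y := by rw [hy]; exact Real.sqrt_nonneg _
  have hny : n * y ^ 2 = Real.log (pn p n) := by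
    rw [hy, Real.sq_sqrt (by positivity)]; field_simp
  have hαN : alphaN α p n = α * y := by rw [alphaN, hy]
  have h3 : √(3 : ℝ) ^ 2 = 3 := Real.sq_sqrt (by norm_num)
  have h30 : 0 ≤ √(3 : ℝ) := Real.sqrt_nonneg _
  set θ := 2 * √(3 : ℝ) + d with hθ
  have hθ0 : 0 < θ := by positivity
  have hα2 : 12 ≤ α ^ 2 := by rw [hα]; nlinarith
  have hsplit : ENNReal.ofReal (3 * (pn p n ^ 2)⁻¹) =
      ENNReal.ofReal (2 * (pn p n ^ 2)⁻¹) + ENNReal.ofReal ((pn p n ^ 2)⁻¹) := by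
    rw [← ENNReal.ofReal_add (by positivity) (by positivity)]; congr 1; ring
  rw [hsplit]
  refine (measure_union_le _ _).trans (add_le_add ?_ ?_)
  · refine sampleLaw_selectionFails_le hn hS (fun ν => ?_) (t := θ * y) (by positivity) hy2 ?_ ?_
      ?_ ?_ ?_
    · rw [spiked_diag]
      linarith [Finset.sum_nonneg fun j (_ : j ∈ Finset.univ) =>
        show 0 ≤ lam j ^ 2 * q j ν ^ 2 by positivity]
    · rw [hαN]
      have h5 : d * y * (θ * y) ≤ d * y * 1 :=
        mul_le_mul_of_nonneg_left (by linarith) (by positivity)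
      have h6 : α * y = θ * y + d * y + d * y := by rw [hα, hθ]; ring
      linarith
    · have h5 : n * (θ * y) ^ 2 / 4 * (1 - 4 * (θ * y)) =
          (n * y ^ 2) * (θ ^ 2 / 4 - θ ^ 3 * y) := by ring
      rw [h5, hny]
      have := mul_le_mul_of_nonneg_left (show 3 ≤ θ ^ 2 / 4 - θ ^ 3 * y by linarith) hL
      linarith
    · rw [hαN, hα]; positivity
    · rw [hαN]; exact hy4
    · rw [hαN]
      have h5 : n * (α * y) ^ 2 / 4 = (n * y ^ 2) * (α ^ 2 / 4) := by ring
      rw [h5, hny]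
      have := mul_le_mul_of_nonneg_left (show 3 ≤ α ^ 2 / 4 by linarith) hL
      linarith
  · refine sampleLaw_varianceDeviates_le hn hS _ (fun ab => ?_) (t := 4 * y) (by linarith)
      (by linarith) ?_ ?_
    · rw [or_iff_not_imp_left]
      intro h0
      rw [dotProduct_spiked_mulVec]
      have h5 : 0 < ‖spikeSums q (largeVariance
        ((∑ j, lam j ^ 2 • Matrix.vecMulVec (q j) (q j)) + 1) (3 * α * y)) ab‖ :=
        norm_pos_iff.2 h0
      positivity
    · have h5 : n * (4 * y) ^ 2 / 4 * (1 - 4 * (4 * y)) = (n * y ^ 2) * (4 * (1 - 16 * y)) := by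
        ring
      rw [h5, hny]
      have := mul_le_mul_of_nonneg_left (show 3 ≤ 4 * (1 - 16 * y) by linarith) hL
      linarith
    · rw [Fintype.card_prod, Fintype.card_fin]
      push_cast
      exact hcard

end SparsePCA

theorem proposition1 :
    ∃ C₀ : ℝ, 0 < C₀ ∧
      ∀ (mbar : ℕ) (r α : ℝ) (p : ℕ → ℕ) (lam s : ℕ → Fin mbar → ℝ),
        1 ≤ mbar → 0 < r → r < 2 → 2 * Real.sqrt 3 < α →
        (∀ n j, 0 < lam n j) → (∀ n, Antitone (lam n)) →
        SparsePCA.GR r p lam → SparsePCA.SP r p lam s →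
        -- claim (1), for every sample size
        (∀ n : ℕ, 1 ≤ n → ∀ Sig ∈ SparsePCA.spikedClass r (p n) (lam n) (s n),
          ∀ (Ω : Type u) [MeasurableSpace Ω] (P : Measure Ω) [IsProbabilityMeasure P]
            (X : Fin n → Ω → EuclideanSpace ℝ (Fin (p n))), SparsePCA.IsSample P Sig X →
            1 - C₀ * (SparsePCA.pn (p n) n ^ 2)⁻¹ ≤
              P.real {ω | SparsePCA.hatM α (fun i => X i ω) ≤ mbar}) ∧
        -- claims (1), (2) and (3) on one event, for all large sample sizes
        ∃ N : ℕ, 1 ≤ N ∧ ∀ n : ℕ, N ≤ n →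
          ∀ Sig ∈ SparsePCA.spikedClass r (p n) (lam n) (s n),
          ∀ (Ω : Type u) [MeasurableSpace Ω] (P : Measure Ω) [IsProbabilityMeasure P]
            (X : Fin n → Ω → EuclideanSpace ℝ (Fin (p n))), SparsePCA.IsSample P Sig X →
            1 - C₀ * (SparsePCA.pn (p n) n ^ 2)⁻¹ ≤
              P.real {ω |
                SparsePCA.hatM α (fun i => X i ω) ≤ mbar ∧
                (∀ m : ℕ, m ≤ mbar → (∃ κ : ℝ, SparsePCA.AD lam m κ) →
                  m ≤ SparsePCA.hatM α (fun i => X i ω)) ∧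
                ((∃ κ : ℝ, SparsePCA.AD lam mbar κ) →
                  SparsePCA.hatM α (fun i => X i ω) = mbar)} := by
  have hexp : 0 < Real.exp 200 := Real.exp_pos _
  refine ⟨Real.exp 200 + 7, by positivity, ?_⟩
  intro mbar r α p lam s hm hr hr2 hα hlam hanti hGR hSP
  constructor
  · rintro n hn Sig ⟨q, hqo, hq, rfl⟩ Ω _ P _ X hX
    -- where `log p_n < 100`, the constant `exp 200` makes the bound trivial
    rcases lt_or_ge (Real.log (SparsePCA.pn (p n) n)) 100 with hL | hL
    · have := SparsePCA.one_le_exp_mul_inv_pn_sq hn hL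
        (show Real.exp 200 ≤ Real.exp 200 + 7 by linarith)
      exact le_trans (by linarith) measureReal_nonneg
    · refine hX.le_measureReal (bad := SparsePCA.noiseExceeds n q)
        (good := fun x => SparsePCA.hatM α x ≤ mbar) (by positivity) ?_ ?_
      · refine (SparsePCA.sampleLaw_noiseExceeds_le hn (lam n) q hL).trans
          (ENNReal.ofReal_le_ofReal (mul_le_mul_of_nonneg_right (by linarith) (by positivity)))
      · intro x hx
        by_contra hcon
        exact hx (SparsePCA.mem_noiseExceeds_of_lt_hatM hn α q (not_le.1 hcon))
  obtain ⟨d, hd⟩ : ∃ d, d = (α - 2 * √3) / 3 := ⟨_, rfl⟩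
  have hd0 : 0 < d := by rw [hd]; linarith
  have hαd : α = 2 * √3 + 3 * d := by rw [hd]; ring
  have h3 : √(3 : ℝ) ^ 2 = 3 := Real.sq_sqrt (by norm_num)
  have h30 : 0 ≤ √(3 : ℝ) := Real.sqrt_nonneg _
  have hα0 : 0 < α := by linarith
  have hm0 : (0 : ℝ) < mbar := by exact_mod_cast hm
  have hy := hGR.tendsto_sqrt
  have hsmall : ∀ A B : ℝ, 0 < B →
      ∀ᶠ n : ℕ in atTop, A * √(Real.log (SparsePCA.pn (p n) n) / n) ≤ B := by
    intro A B hB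
    have := (hy.const_mul A).eventually_le_const (u := B) (by simpa using hB)
    exact this
  have hcard : ∀ᶠ n : ℕ in atTop, 2 * ((mbar : ℝ) * mbar) ≤ SparsePCA.pn (p n) n := by
    filter_upwards [eventually_ge_atTop (2 * (mbar * mbar))] with n hn
    refine le_trans ?_ (SparsePCA.le_pn_right _ _)
    exact_mod_cast hn
  -- for each detectable `m`, the exceptional events exclude `m̂ < m` once `n` is large
  have hdetect : ∀ m ∈ Finset.Icc 1 mbar, ∀ᶠ n : ℕ in atTop,
      (∃ κ : ℝ, SparsePCA.AD lam m κ) → ∀ q : Fin mbar → EuclideanSpace ℝ (Fin (p n)),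
        Orthonormal ℝ q → (∀ j, SparsePCA.WeakBall r (s n j) (q j)) →
        ∀ x : Fin n → EuclideanSpace ℝ (Fin (p n)),
        x ∉ SparsePCA.selectionFails α (d * √(Real.log (SparsePCA.pn (p n) n) / n))
            (3 * SparsePCA.alphaN α (p n) n)
            ((∑ j, lam n j ^ 2 • Matrix.vecMulVec (q j) (q j)) + 1) ∪
          SparsePCA.varianceDeviates (4 * √(Real.log (SparsePCA.pn (p n) n) / n))
            ((∑ j, lam n j ^ 2 • Matrix.vecMulVec (q j) (q j)) + 1)
            (SparsePCA.spikeSums q (SparsePCA.largeVariance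
              ((∑ j, lam n j ^ 2 • Matrix.vecMulVec (q j) (q j)) + 1)
              (3 * α * √(Real.log (SparsePCA.pn (p n) n) / n)))) →
        m ≤ SparsePCA.hatM α x := by
    intro m hmm
    obtain ⟨hm1, hm2⟩ := Finset.mem_Icc.1 hmm
    by_cases hAD : ∃ κ : ℝ, SparsePCA.AD lam m κ
    swap
    · exact Eventually.of_forall fun n h => absurd h hAD
    obtain ⟨κ, hκ, hAD'⟩ := hAD
    have hgap := hAD'.resolve_left (by omega)
    obtain ⟨k, rfl⟩ : ∃ k, m = k + 1 := ⟨m - 1, by omega⟩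
    have h2r : 0 < 2 - r := by linarith
    obtain ⟨c, hc0, hc1, hc2, hc3⟩ := SparsePCA.exists_small_constant
      (A := 2 / (2 - r) * (3 * α) ^ (1 - r / 2) * mbar) (B := 128 * mbar * κ)
      (D := 10 * (mbar * (d / mbar) ^ (-(r / 2))) + 12) (e := 1 / (8 * κ))
      (by positivity)
    filter_upwards [hgap, hGR.eventually_sqrt_le hm hlam hanti hc0,
      eventually_all.2 fun j => hSP.eventually_le hlam hc0 j,
      eventually_all.2 fun j => hSP.one_le j, SparsePCA.eventually_le_log_pn p 1,
      eventually_ge_atTop 1] with n hn1 hn2 hn3 hn4 hn5 hn6 _ q hqo hq x hx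
    rw [Set.mem_union, not_or] at hx
    have hn0 : (0 : ℝ) < n := by exact_mod_cast hn6
    refine SparsePCA.le_hatM_of_not_mem (lam := lam n) (s := s n) (q := q) hn6 hm hr hr2 (hlam n)
      (fun j => lt_of_lt_of_le one_pos (hn4 j)) hqo hq hm2
      (b := d / mbar) (c := c) (μ := SparsePCA.spikeSq lam n 1) (κ := κ)
      (l := SparsePCA.spikeSq lam n (k + 1)) hα0 (by positivity)
      (Real.sqrt_pos.2 (by positivity)) hn5 rfl hκ hc0
      (fun j => SparsePCA.sq_le_spikeSq_one hm hlam hanti n j) ?_ ?_ hn2 hn3 ?_ hc2 hc3 ?_ hx.2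
    · intro a
      rw [SparsePCA.spikeSq_eq n ⟨hm1, hm2⟩]
      refine pow_le_pow_left₀ (hlam _ _).le (hanti n ?_) 2
      rw [Fin.le_def]
      have := a.2
      simp only [Fin.val_castLE]
      omega
    · linarith [SparsePCA.spikeSq_nonneg (lam := lam) n (k + 1 + 1)]
    · linarith
    · have : (mbar : ℝ) * (d / mbar) = d := by field_simp
      rw [this]; exact hx.1
  have hev := (eventually_all_finset (Finset.Icc 1 mbar)).2 hdetect
  obtain ⟨N, hN⟩ := eventually_atTop.1 (hev.and (hcard.and
    ((SparsePCA.eventually_le_log_pn p 100).and ((hsmall 1 (1 / 64) (by norm_num)).and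
    ((hsmall (2 * √3 + d) (1 / 2) (by norm_num)).and
    ((hsmall ((2 * √3 + d) ^ 3) ((2 * √3 + d) ^ 2 / 4 - 3) (by nlinarith)).and
    (hsmall α (1 / 3) (by norm_num))))))))
  refine ⟨max N 1, le_max_right _ _, ?_⟩
  rintro n hn Sig ⟨q, hqo, hq, rfl⟩ Ω _ P _ X hX
  obtain ⟨hdet, hc, hL, hy1, hy2, hy3, hy4⟩ := hN n ((le_max_left _ _).trans hn)
  have hn1 : 1 ≤ n := (le_max_right _ _).trans hn
  rw [one_mul] at hy1
  have hbad1 := SparsePCA.sampleLaw_noiseExceeds_le hn1 (lam n) q hL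
  have hbad2 := SparsePCA.sampleLaw_selection_deviation_le hn1 (lam n) q hd0 hαd rfl hc hy1 hy2
    hy3 hy4
  refine hX.le_measureReal (good := fun x => SparsePCA.hatM α x ≤ mbar ∧
      (∀ m : ℕ, m ≤ mbar → (∃ κ : ℝ, SparsePCA.AD lam m κ) → m ≤ SparsePCA.hatM α x) ∧
      ((∃ κ : ℝ, SparsePCA.AD lam mbar κ) → SparsePCA.hatM α x = mbar)) (by positivity)
    ((measure_union_le _ _).trans ((add_le_add hbad1 hbad2).trans ?_)) ?_
  · rw [← ENNReal.ofReal_add (by positivity) (by positivity), ← add_mul]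
    exact ENNReal.ofReal_le_ofReal
      (mul_le_mul_of_nonneg_right (by linarith) (by positivity))
  · intro x hx
    rw [Set.mem_union, not_or] at hx
    have hup : SparsePCA.hatM α x ≤ mbar := by
      by_contra hcon
      exact hx.1 (SparsePCA.mem_noiseExceeds_of_lt_hatM hn1 α q (not_le.1 hcon))
    have hlow : ∀ m : ℕ, m ≤ mbar → (∃ κ : ℝ, SparsePCA.AD lam m κ) →
        m ≤ SparsePCA.hatM α x := by
      intro m hmm hAD
      rcases Nat.eq_zero_or_pos m with rfl | hpos
      · exact Nat.zero_le _
      · exact hdet m (Finset.mem_Icc.2 ⟨hpos, hmm⟩) hAD q hqo hq x hx.2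
    exact ⟨hup, hlow, fun hAD => le_antisymm hup (hlow mbar le_rfl hAD)⟩
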